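/- Let $M\ge 2$ be an integer, $\tau>1$ and $K>0$. There is a constant $C_\tau>0$, depending only on $M$, $\tau$ and $K$, such that the following holds for every $n$. Let $H=\bigcup_{m=2}^{M}H_m$ be an inhomogeneous Erdős–Rényi random hypergraph on $[n]$: for each $m\in\{2,\dots,M\}$, every $m$-element subset $e=\{i_1,\dots,i_m\}$ of $[n]$ is a hyperedge of $H_m$ with probability $d_e/\binom{n}{m-1}\in[0,1]$, where the numbers $d_e=d_{[i_1,\dots,i_m]}$ are given, and all these events (over all $e$ and all $m$) are independent. Let $d_m=\max_{|e|=m}d_e$ (with $d_m=0$ if $m>n$) and $d=\sum_{m=2}^{M}(m-1)d_m$; no lower bound on $d$ is assumed. Let $A$ be the adjacency matrix of $H$, that is, the $n\times n$ matrix with $A_{ii}=0$ and, for $i\ne j$, $A_{ij}$ equal to the number of hyperedges of $H$ containing both $i$ and $j$. Let $\mathcal I=\{i\in[n]:\sum_{j}A_{ij}\le\tau d\}$, and for an $n\times n$ matrix $B$ let $B_{\mathcal I}$ be the matrix obtained from $B$ by replacing with zeros all rows and columns not indexed by $\mathcal I$. Then, with $\|\cdot\|$ the spectral norm and $\mathbb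 E A$ the entrywise expectation, $$\mathbb P\Big(\|(A-\mathbb E A)_{\mathcal I}\|\le C_\tau\sqrt d\Big)\ \ge\ 1-2\Big(\frac e2\Big)^{-n}-n^{-K}.$$ -/

import Mathlib

open MeasureTheory ProbabilityTheory

noncomputable section

/-- An Erdős–Rényi inhomogeneous random hypergraph on the vertex set `Fin n` whose hyperedges have
sizes `2, …, M`: every set `e` of `m` vertices, `2 ≤ m ≤ M`, is a hyperedge with probability
`w e / (n choose (m - 1))`, independently of all the others (of the same or of another size).
`H ω` is the set of all hyperedges; its members of size `m` form the uniform part `H_m`. -/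
structure IsInhomogeneousHypergraph {Ω : Type*} [MeasurableSpace Ω] (μ : Measure Ω) {n : ℕ}
    (M : ℕ) (w : Finset (Fin n) → ℝ) (H : Ω → Set (Finset (Fin n))) : Prop where
  size_mem : ∀ ω, ∀ e ∈ H ω, 2 ≤ e.card ∧ e.card ≤ M
  measurableSet_mem : ∀ e, MeasurableSet {ω | e ∈ H ω}
  indep : iIndepSet
    (fun e : {e : Finset (Fin n) // 2 ≤ e.card ∧ e.card ≤ M} => {ω | (e : Finset (Fin n)) ∈ H ω}) μ
  prob_mem : ∀ e : Finset (Fin n), 2 ≤ e.card → e.card ≤ M →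
    μ.real {ω | e ∈ H ω} = w e / (n.choose (e.card - 1) : ℝ)

/-- `d_m`, the maximum of `w e` over all sets `e` of `m` vertices
(it is `0` if there is no such set, that is, if `n < m`). -/
def maxWeight {n : ℕ} (w : Finset (Fin n) → ℝ) (m : ℕ) : ℝ :=
  ⨆ e : {e : Finset (Fin n) // e.card = m}, w e

/-- `d = ∑_{m=2}^M (m - 1) d_m`. -/
def degreeParam {n : ℕ} (M : ℕ) (w : Finset (Fin n) → ℝ) : ℝ :=
  ∑ m ∈ Finset.Icc 2 M, ((m : ℝ) - 1) * maxWeight w m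

/-- The adjacency tensor of the hypergraph with set of hyperedges `H`: the entry of a set `e` of
vertices is `1` if `e` is a hyperedge and `0` otherwise. -/
def adjTensor {n : ℕ} (H : Set (Finset (Fin n))) (e : Finset (Fin n)) : ℝ :=
  H.indicator (fun _ => (1 : ℝ)) e

/-- The adjacency matrix: for `i ≠ j` the entry `A i j` is the number of hyperedges of sizes
`2, …, M` that contain both `i` and `j`; the diagonal is zero. -/
def hyperAdjMatrix {n : ℕ} (M : ℕ) (H : Set (Finset (Fin n))) : Matrix (Fin n) (Fin n) ℝ :=
  Matrix.of fun i j =>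
    if i = j then 0
    else ∑ m ∈ Finset.Icc 2 M,
      ∑ e ∈ (Finset.powersetCard m (Finset.univ : Finset (Fin n))).filter
        (fun e => i ∈ e ∧ j ∈ e), adjTensor H e

/-- The entrywise expectation of a random matrix. -/
def expectedMatrix {Ω : Type*} [MeasurableSpace Ω] (μ : Measure Ω) {n : ℕ}
    (A : Ω → Matrix (Fin n) (Fin n) ℝ) : Matrix (Fin n) (Fin n) ℝ :=
  Matrix.of fun i j => ∫ ω, A ω i j ∂μ

/-- `row(i)`, the sum of the `i`-th row. -/
def rowSum {n : ℕ} (A : Matrix (Fin n) (Fin n) ℝ) (i : Fin n) : ℝ := ∑ j, A i j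

open Classical in
/-- The matrix obtained from `A` by zeroing out the rows and columns not indexed by `I`. -/
def regularize {n : ℕ} (A : Matrix (Fin n) (Fin n) ℝ) (I : Set (Fin n)) :
    Matrix (Fin n) (Fin n) ℝ :=
  Matrix.of fun i j => if i ∈ I ∧ j ∈ I then A i j else 0

/-- The spectral norm: the operator norm with respect to the Euclidean norm on `ℝⁿ`. -/
def matrixSpectralNorm {n : ℕ} (A : Matrix (Fin n) (Fin n) ℝ) : ℝ :=
  ‖Matrix.toEuclideanCLM (n := Fin n) (𝕜 := ℝ) A‖

end

/-! The argument follows the Kahn–Szemerédi light/heavy scheme. Scaled by `√n`, the unit vectors in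
the bilinear form of the regularized matrix can be rounded to integer vectors of squared norm at
most `4 n` without decreasing the form (`matrixSpectralNorm_le_of_int_vectors`). There are at most
`exp (6 n)` such vectors (`card_intNet_le`), so a union bound over pairs costs `exp (12 n)`. Zeroing
rows and columns is absorbed into the vectors, by setting their coordinates outside the index set to
zero.

The adjacency matrix is a sum of independent multiples of clique matrices, one per possible
hyperedge, and the entries of its mean are at most `d / n`. Pairs with `|k i * l j| ≤ √d` are light:
one hyperedge then changes their sum by at most `M ^ 2 * √d`, and Chernoff's bound gives a tail `exp
(-16 n)` for deviations of order `n * √d` (`measureReal_light_sum_ge_le`), which survives the union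
bound.

For the heavy pairs cancellation is not needed. The mean contributes `O (n * √d)`, since `|k i * l
j|` is at most its square over `√d`. For the random part the coordinates are grouped into dyadic
levels. Row sums are at most `τ * d` on the index set, and with probability at least `1 - n ^ (-K)`
no two vertex sets carry much more weight than expected (`measureReal_not_hasDiscrepancy_le`). For
each pair of levels one of these two bounds yields one of five terms, and each term sums to `O (n *
√d)` (`level_pair_bound`, `sum_level_pairs_le`, `heavy_sum_le`). Since deviations are compared with
`d` itself, `d > 0` is enough, and `d = 0` is trivial. -/

/-! ### Summation over pairs of dyadic levels. -/

/-- The number `x`, replaced by `0` if it exceeds the threshold `κ`. -/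
noncomputable def cutoff (κ x : ℝ) : ℝ := if x ≤ κ then x else 0

theorem cutoff_of_le {κ x : ℝ} (h : x ≤ κ) : cutoff κ x = x := if_pos h

theorem cutoff_nonneg {κ x : ℝ} (h : 0 ≤ x) : 0 ≤ cutoff κ x := by
  unfold cutoff
  split_ifs <;> simp [h]

/-- The surviving terms form part of a geometric progression, so their sum is at most twice the
largest one, which is at most `κ`. The bound does not involve `c`; this is what allows one level
index to be summed out uniformly in the other. -/
theorem sum_ite_mul_two_pow_le (F : Finset ℕ) {c κ : ℝ} (hc : 0 ≤ c) (hκ : 0 ≤ κ) :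
    ∑ b ∈ F, cutoff κ (c * 2 ^ b) ≤ 2 * κ := by
  simp only [cutoff]
  rw [← Finset.sum_filter]
  rcases (F.filter fun b => c * 2 ^ b ≤ κ).eq_empty_or_nonempty with h | h
  · rw [h]; simpa using hκ
  · obtain ⟨m, hm, hmax⟩ := Finset.exists_max_image _ id h
    have h1 : ∑ b ∈ F.filter (fun b => c * 2 ^ b ≤ κ), c * (2 : ℝ) ^ b
        ≤ ∑ b ∈ Finset.range (m + 1), c * (2 : ℝ) ^ b := by
      refine Finset.sum_le_sum_of_subset_of_nonneg (fun b hb => ?_) fun _ _ _ => by positivity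
      have := hmax b hb
      simp only [id] at this
      simpa using Nat.lt_succ_of_le this
    have h2 : ∑ b ∈ Finset.range (m + 1), (2 : ℝ) ^ b = 2 ^ (m + 1) - 1 := by
      rw [geom_sum_eq (by norm_num)]; norm_num
    have h3 := (Finset.mem_filter.1 hm).2
    have h4 : ∑ b ∈ Finset.range (m + 1), c * (2 : ℝ) ^ b = c * (2 ^ m * 2 - 1) := by
      rw [← Finset.mul_sum, h2, pow_succ]
    linarith

theorem sum_ite_div_two_pow_le (F : Finset ℕ) {c κ : ℝ} (hc : 0 ≤ c) (hκ : 0 ≤ κ) :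
    ∑ b ∈ F, cutoff κ (c / 2 ^ b) ≤ 2 * κ := by
  simp only [cutoff]
  rw [← Finset.sum_filter]
  rcases (F.filter fun b => c / 2 ^ b ≤ κ).eq_empty_or_nonempty with h | h
  · rw [h]; simpa using hκ
  · obtain ⟨m, hm, hmin⟩ := Finset.exists_min_image _ id h
    obtain ⟨N, hN⟩ : ∃ N, ∀ b ∈ F, b < N := ⟨F.sup id + 1, fun b hb =>
      Nat.lt_succ_of_le (Finset.le_sup (f := id) hb)⟩
    have h1 : ∑ b ∈ F.filter (fun b => c / 2 ^ b ≤ κ), c / (2 : ℝ) ^ b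
        ≤ ∑ b ∈ Finset.Ico m N, c / (2 : ℝ) ^ b := by
      refine Finset.sum_le_sum_of_subset_of_nonneg (fun b hb => ?_) fun _ _ _ => by positivity
      have := hmin b hb
      simp only [id] at this
      exact Finset.mem_Ico.2 ⟨this, hN b (Finset.mem_filter.1 hb).1⟩
    have h2 : ∀ N, ∑ b ∈ Finset.Ico m N, c / (2 : ℝ) ^ b ≤ 2 * (c / 2 ^ m) := by
      intro N
      rcases le_total N m with h | h
      · rw [Finset.Ico_eq_empty_of_le h]; simp; positivity
      · have : ∑ b ∈ Finset.Ico m N, c / (2 : ℝ) ^ b = 2 * (c / 2 ^ m) - 2 * (c / 2 ^ N) := by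
          induction N, h using Nat.le_induction with
          | base => simp
          | succ k hk ih => rw [Finset.sum_Ico_succ_top hk, ih, pow_succ]; field_simp; ring
        rw [this]
        have : 0 ≤ c / 2 ^ N := by positivity
        linarith
    have h3 := (Finset.mem_filter.1 hm).2
    linarith [h2 N]

set_option maxHeartbeats 1000000 in
/-- The contribution of one pair of dyadic levels, split according to which of the degree bound and
the discrepancy bound controls it. -/
theorem level_pair_bound {n d τ C u s t : ℝ} {a b : ℕ} (hn : 0 < n) (hd : 0 < d) (hτ : 0 ≤ τ)
    (hC : 0 ≤ C) (hs : 0 < s) (ht : 0 < t) (hheavy : √d < 4 * 2 ^ (a + b))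
    (hdeg : u ≤ τ * d * s)
    (hdisc : u ≤ Real.exp 2 * (d * s * t / n) ∨
      u * Real.log (u / (d * s * t / n)) ≤ C * (t * Real.log (Real.exp 1 * n / t))) :
    2 ^ (a + b) * u ≤ √d * (
      4 * Real.exp 2 / n * ((4 ^ a * s) * (4 ^ b * t)) +
      τ * (4 ^ a * s) * cutoff 1 (√d / 2 ^ a * 2 ^ b) +
      4 * C * (4 ^ b * t) * cutoff 1 (1 / (√d * 2 ^ b) * 2 ^ a) +
      4 * C * (4 ^ b * t) * cutoff 2 (1 / √d * 2 ^ a) +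
      2 * (4 ^ a * s) * cutoff 4 (√d / 2 ^ a / 2 ^ b)) := by
  set q := √d with hq
  have hq0 : 0 < q := Real.sqrt_pos.2 hd
  have hdq : d = q * q := (Real.mul_self_sqrt hd.le).symm
  have e4 : ∀ k : ℕ, (4 : ℝ) ^ k = 2 ^ k * 2 ^ k := fun k => by rw [← mul_pow]; norm_num
  have e16 : ∀ k : ℕ, (16 : ℝ) ^ k = 2 ^ k * 2 ^ k * (2 ^ k * 2 ^ k) := fun k => by
    rw [← mul_pow, ← mul_pow]; norm_num
  have hA : (1 : ℝ) ≤ 2 ^ a := one_le_pow₀ (by norm_num)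
  have hB : (1 : ℝ) ≤ 2 ^ b := one_le_pow₀ (by norm_num)
  have e16b := e16 b
  have h3b : 1 + 3 * (b : ℝ) ≤ 4 * 2 ^ b := by
    have := one_add_mul_le_pow (a := (1 : ℝ)) (by norm_num) b
    norm_num at this
    linarith
  rw [pow_add] at hheavy ⊢
  rw [e4, e4]
  generalize hα : (2 : ℝ) ^ a = α at *
  generalize hβ : (2 : ℝ) ^ b = β at *
  have hα0 : 0 < α := by linarith
  have hβ0 : 0 < β := by linarith
  have p1 : 0 ≤ 4 * Real.exp 2 / n * (α * α * s * (β * β * t)) := by positivity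
  have p2 : 0 ≤ τ * (α * α * s) * cutoff 1 (q / α * β) :=
    mul_nonneg (by positivity) (cutoff_nonneg (by positivity))
  have p3 : 0 ≤ 4 * C * (β * β * t) * cutoff 1 (1 / (q * β) * α) :=
    mul_nonneg (by positivity) (cutoff_nonneg (by positivity))
  have p4 : 0 ≤ 4 * C * (β * β * t) * cutoff 2 (1 / q * α) :=
    mul_nonneg (by positivity) (cutoff_nonneg (by positivity))
  have p5 : 0 ≤ 2 * (α * α * s) * cutoff 4 (q / α / β) :=
    mul_nonneg (by positivity) (cutoff_nonneg (by positivity))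
  generalize hR : 4 * Real.exp 2 / n * (α * α * s * (β * β * t)) +
    τ * (α * α * s) * cutoff 1 (q / α * β) +
    4 * C * (β * β * t) * cutoff 1 (1 / (q * β) * α) +
    4 * C * (β * β * t) * cutoff 2 (1 / q * α) +
    2 * (α * α * s) * cutoff 4 (q / α / β) = R
  have r1 : 4 * Real.exp 2 / n * (α * α * s * (β * β * t)) ≤ R := by linarith
  have r2 : τ * (α * α * s) * cutoff 1 (q / α * β) ≤ R := by linarith
  have r3 : 4 * C * (β * β * t) * cutoff 1 (1 / (q * β) * α) ≤ R := by linarith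
  have r4 : 4 * C * (β * β * t) * cutoff 2 (1 / q * α) ≤ R := by linarith
  have r5 : 2 * (α * α * s) * cutoff 4 (q / α / β) ≤ R := by linarith
  clear hR p1 p2 p3 p4 p5
  set m := d * s * t / n with hm
  have hm0 : 0 < m := by positivity
  have he2 : (1 : ℝ) ≤ Real.exp 2 := Real.one_le_exp (by norm_num)
  have case1 : u ≤ Real.exp 2 * m ∨ u * q ≤ α * β * m →
      α * β * u ≤ q * (4 * Real.exp 2 / n * (α * α * s * (β * β * t))) := by
    have key : α * β * (4 * Real.exp 2 * (α * β) * m / q)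
        = q * (4 * Real.exp 2 / n * (α * α * s * (β * β * t))) := by
      rw [hm, hdq]; field_simp
    intro h
    rw [← key]
    refine mul_le_mul_of_nonneg_left ?_ (by positivity)
    rw [le_div_iff₀ hq0]
    rcases h with h | h
    · calc u * q ≤ Real.exp 2 * m * q := by gcongr
        _ ≤ Real.exp 2 * m * (4 * (α * β)) := by gcongr
        _ = _ := by ring
    · have : 0 < α * β * m := by positivity
      nlinarith
  -- Either alternative gives `u ≤ 4 * exp 2 * (α * β / q) * m`: by `hheavy` the ratio `α * β / q`
  -- exceeds `1 / 4`, which covers the first one.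
  by_cases h1 : u ≤ Real.exp 2 * m ∨ u * q ≤ α * β * m
  · refine (case1 h1).trans (mul_le_mul_of_nonneg_left r1 hq0.le)
  clear case1
  push Not at h1
  obtain ⟨h1, h1'⟩ := h1
  have hu0 : 0 < u := lt_trans (by positivity) h1
  replace hdisc := hdisc.resolve_left (not_le.2 h1)
  -- When `α` dominates `q * β` the degree bound suffices; otherwise the discrepancy bound has to be
  -- used.
  by_cases h2 : q / α * β ≤ 1
  · have : α * β * u ≤ q * (τ * (α * α * s) * cutoff 1 (q / α * β)) := by
      rw [cutoff_of_le h2]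
      calc α * β * u ≤ α * β * (τ * d * s) := by gcongr
        _ = _ := by rw [hdq]; field_simp
    refine this.trans (mul_le_mul_of_nonneg_left r2 hq0.le)
  have h3 : 1 / (q * β) * α ≤ 1 := by
    have h2 : 1 < q * β / α := by rw [not_le] at h2; rwa [mul_div_right_comm]
    rw [lt_div_iff₀ hα0] at h2
    rw [div_mul_eq_mul_div, div_le_one (by positivity)]
    linarith
  set r := u / m with hr
  have hur : u = r * m := by rw [hr]; field_simp
  have hr2 : Real.exp 2 < r := by rw [hr, lt_div_iff₀ hm0]; exact h1
  have hr0 : 0 < r := lt_trans (by positivity) hr2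
  have hlog : 2 < Real.log r := by rwa [Real.lt_log_iff_exp_lt hr0]
  have hle : Real.log (Real.exp 1 * n / t) = 1 + Real.log (n / t) := by
    rw [mul_div_assoc, Real.log_mul (by positivity) (by positivity), Real.log_exp]
  -- If `log r` is comparable with the entropy per vertex, the logarithms cancel in `hdisc`.
  -- Otherwise `r` is at most of order `(n / t) ^ (1 / 4)`.
  by_cases h4 : Real.log (Real.exp 1 * n / t) / 4 ≤ Real.log r
  · have hu : u ≤ 4 * C * t := by
      have h5 : u * Real.log r ≤ C * (t * (4 * Real.log r)) :=
        hdisc.trans (by gcongr; linarith)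
      have : u * Real.log r ≤ (4 * C * t) * Real.log r := by linarith
      exact le_of_mul_le_mul_right this (by linarith)
    have : α * β * u ≤ q * (4 * C * (β * β * t) *
        cutoff 1 (1 / (q * β) * α)) := by
      rw [cutoff_of_le h3]
      calc α * β * u ≤ α * β * (4 * C * t) := by gcongr
        _ = _ := by field_simp
    refine this.trans (mul_le_mul_of_nonneg_left r3 hq0.le)
  have hr4 : r ^ 4 < 16 * (n / t) := by
    have h5 : Real.log (r ^ 4) < Real.log (Real.exp 1 * n / t) := by
      rw [Real.log_pow]; push_cast; linarith
    have h6 := (Real.log_lt_log_iff (by positivity) (by positivity)).1 h5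
    have h7 : Real.exp 1 < 16 := by linarith [Real.exp_one_lt_d9]
    calc r ^ 4 < Real.exp 1 * (n / t) := by rw [← mul_div_assoc]; exact h6
      _ ≤ 16 * (n / t) := by gcongr
  -- For `n / t ≤ 16 ^ b` the entropy per vertex is at most `1 + 3 * b ≤ 4 * β`, and `r < 2 * β`;
  -- combined with the failure of `h1`, that is `α * β < r * q`, this gives `α < 2 * q`.
  by_cases h5 : n / t ≤ 16 ^ b
  · have hL : Real.log (Real.exp 1 * n / t) ≤ 4 * β := by
      rw [hle]
      have : Real.log (n / t) ≤ b * Real.log 16 := by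
        rw [← Real.log_pow]; exact Real.log_le_log (by positivity) h5
      have h16 : Real.log 16 ≤ 3 := by
        rw [show (16 : ℝ) = 2 ^ 4 by norm_num, Real.log_pow]
        push_cast
        linarith [Real.log_two_lt_d9]
      have : (b : ℝ) * Real.log 16 ≤ b * 3 := by gcongr
      linarith
    have hu : u ≤ 4 * C * t * β := by
      calc u = u * 1 := by ring
        _ ≤ u * Real.log r := by gcongr; linarith
        _ ≤ _ := hdisc
        _ ≤ C * (t * (4 * β)) := by gcongr
        _ = _ := by ring
    have hrb : r < 2 * β := by
      refine lt_of_pow_lt_pow_left₀ 4 (by positivity) (hr4.trans_le ?_)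
      rw [e16b] at h5
      calc 16 * (n / t) ≤ 16 * (β * β * (β * β)) := by gcongr
        _ = _ := by ring
    have hα2 : 1 / q * α ≤ 2 := by
      rw [div_mul_eq_mul_div, div_le_iff₀ hq0, one_mul]
      have h6 : α * β * m < r * q * m := by rw [hur] at h1'; linarith
      have h7 : α * β < r * q := lt_of_mul_lt_mul_right h6 hm0.le
      have h8 : r * q < 2 * β * q := by gcongr
      have h9 : α * β < (2 * q) * β := by linarith
      exact (lt_of_mul_lt_mul_right h9 hβ0.le).le
    have : α * β * u ≤ q * (4 * C * (β * β * t) *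
        cutoff 2 (1 / q * α)) := by
      rw [cutoff_of_le hα2]
      calc α * β * u ≤ α * β * (4 * C * t * β) := by gcongr
        _ = _ := by field_simp
    refine this.trans (mul_le_mul_of_nonneg_left r4 hq0.le)
  · rw [not_le, e16b] at h5
    have h6 : q / α / β ≤ 4 := by
      rw [div_div, div_le_iff₀ (by positivity)]; exact hheavy.le
    generalize hy : n / t = y at *
    have hy0 : 0 < y := lt_trans (by positivity) h5
    -- Here `β ^ 4 < y`, so the fourth root bound on `r` is far below `y / β ^ 2`. Then `u ≤ 2 * d *
    -- s / β ^ 2`, a gain of `β ^ 2` over the degree bound, and `hheavy` supplies the last cutoff.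
    have hrb : r ≤ 2 * (y / (β * β)) := by
      refine le_of_lt (lt_of_pow_lt_pow_left₀ 4 (by positivity) (hr4.trans_le ?_))
      have h7 : (β * β) ^ 4 ≤ y ^ 3 := by
        calc (β * β) ^ 4 ≤ (β * β) ^ 6 := pow_le_pow_right₀ (by nlinarith) (by norm_num)
          _ = (β * β * (β * β)) ^ 3 := by ring
          _ ≤ y ^ 3 := by gcongr
      rw [mul_pow, div_pow, ← mul_div_assoc, le_div_iff₀ (by positivity)]
      nlinarith
    have : α * β * u ≤ q * (2 * (α * α * s) *
        cutoff 4 (q / α / β)) := by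
      rw [cutoff_of_le h6]
      calc α * β * u = α * β * (r * m) := by rw [hur]
        _ ≤ α * β * (2 * (y / (β * β)) * m) := by gcongr
        _ = _ := by rw [hm, hdq, ← hy]; field_simp
    refine this.trans (mul_le_mul_of_nonneg_left r5 hq0.le)

/-- The first of the five terms factors into the two second moments. In each of the others only one
moment occurs, and the cutoff is summed over the free level index as a geometric series. -/
theorem sum_level_pairs_le {n d τ C : ℝ} (F G : Finset ℕ) (P : ℕ → ℕ → Prop)
    [∀ a b, Decidable (P a b)] (s t : ℕ → ℝ) (u : ℕ → ℕ → ℝ)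
    (hn : 0 < n) (hd : 0 < d) (hτ : 0 ≤ τ) (hC : 0 ≤ C) (hs0 : ∀ a, 0 ≤ s a) (ht0 : ∀ b, 0 ≤ t b)
    (hs : ∑ a ∈ F, 4 ^ a * s a ≤ 4 * n) (ht : ∑ b ∈ G, 4 ^ b * t b ≤ 4 * n)
    (hP : ∀ a b, P a b → 0 < s a ∧ 0 < t b ∧ √d < 4 * 2 ^ (a + b) ∧ u a b ≤ τ * d * s a ∧
      (u a b ≤ Real.exp 2 * (d * s a * t b / n) ∨
      u a b * Real.log (u a b / (d * s a * t b / n)) ≤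
        C * (t b * Real.log (Real.exp 1 * n / t b)))) :
    ∑ a ∈ F, ∑ b ∈ G, (if P a b then 2 ^ (a + b) * u a b else 0) ≤
      (64 * Real.exp 2 + 8 * τ + 96 * C + 64) * n * √d := by
  have hx : ∀ a, 0 ≤ 4 ^ a * s a := fun a => mul_nonneg (by positivity) (hs0 a)
  have hy : ∀ b, 0 ≤ 4 ^ b * t b := fun b => mul_nonneg (by positivity) (ht0 b)
  have h1 : ∀ a b, (if P a b then 2 ^ (a + b) * u a b else 0) ≤ √d * (
      4 * Real.exp 2 / n * ((4 ^ a * s a) * (4 ^ b * t b)) +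
      τ * (4 ^ a * s a) * cutoff 1 (√d / 2 ^ a * 2 ^ b) +
      4 * C * (4 ^ b * t b) *
        cutoff 1 (1 / (√d * 2 ^ b) * 2 ^ a) +
      4 * C * (4 ^ b * t b) * cutoff 2 (1 / √d * 2 ^ a) +
      2 * (4 ^ a * s a) * cutoff 4 (√d / 2 ^ a / 2 ^ b)) := by
    intro a b
    split_ifs with h
    · obtain ⟨h1, h2, h3, h4, h5⟩ := hP a b h
      exact level_pair_bound hn hd hτ hC h1 h2 h3 h4 h5
    · have := hx a
      have := hy b
      have p2 : 0 ≤ τ * (4 ^ a * s a) * cutoff 1 (√d / 2 ^ a * 2 ^ b) :=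
        mul_nonneg (mul_nonneg hτ (hx a)) (cutoff_nonneg (by positivity))
      have p3 : 0 ≤ 4 * C * (4 ^ b * t b) * cutoff 1 (1 / (√d * 2 ^ b) * 2 ^ a) :=
        mul_nonneg (mul_nonneg (mul_nonneg (by norm_num : (0 : ℝ) ≤ 4) hC) (hy b))
        (cutoff_nonneg (by positivity))
      have p4 : 0 ≤ 4 * C * (4 ^ b * t b) * cutoff 2 (1 / √d * 2 ^ a) :=
        mul_nonneg (mul_nonneg (mul_nonneg (by norm_num : (0 : ℝ) ≤ 4) hC) (hy b))
        (cutoff_nonneg (by positivity))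
      have p5 : 0 ≤ 2 * (4 ^ a * s a) * cutoff 4 (√d / 2 ^ a / 2 ^ b) :=
        mul_nonneg (mul_nonneg (by norm_num : (0 : ℝ) ≤ 2) (hx a))
        (cutoff_nonneg (by positivity))
      have p1 : 0 ≤ 4 * Real.exp 2 / n * ((4 ^ a * s a) * (4 ^ b * t b)) := by positivity
      exact mul_nonneg (by positivity) (by linarith)
  refine (Finset.sum_le_sum fun a _ => Finset.sum_le_sum fun b _ => h1 a b).trans ?_
  simp only [← Finset.mul_sum, Finset.sum_add_distrib]
  have q1 : (∑ a ∈ F, (4 ^ a * s a)) * ∑ b ∈ G, (4 ^ b * t b) ≤ 4 * n * (4 * n) :=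
    mul_le_mul hs ht (Finset.sum_nonneg fun b _ => hy b) (by positivity)
  have q2 : ∑ a ∈ F, τ * (4 ^ a * s a) *
      ∑ b ∈ G, cutoff 1 (√d / 2 ^ a * 2 ^ b) ≤ τ * (4 * n) * 2 := by
    calc _ ≤ ∑ a ∈ F, τ * (4 ^ a * s a) * (2 * 1) := by
          refine Finset.sum_le_sum fun a _ => mul_le_mul_of_nonneg_left ?_ (mul_nonneg hτ (hx a))
          exact sum_ite_mul_two_pow_le G (by positivity) (by positivity)
      _ = τ * (∑ a ∈ F, (4 ^ a * s a)) * 2 := by rw [← Finset.sum_mul, ← Finset.mul_sum]; ring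
      _ ≤ _ := by gcongr
  have q3 : ∑ a ∈ F, ∑ b ∈ G, 4 * C * (4 ^ b * t b) *
      cutoff 1 (1 / (√d * 2 ^ b) * 2 ^ a)
      ≤ 4 * C * (4 * n) * 2 := by
    rw [Finset.sum_comm]
    simp only [← Finset.mul_sum]
    calc _ ≤ ∑ b ∈ G, 4 * C * (4 ^ b * t b) * (2 * 1) := by
          refine Finset.sum_le_sum fun b _ => mul_le_mul_of_nonneg_left ?_
            (mul_nonneg (by positivity) (hy b))
          exact sum_ite_mul_two_pow_le F (by positivity) (by positivity)
      _ = 4 * C * (∑ b ∈ G, (4 ^ b * t b)) * 2 := by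
          rw [← Finset.sum_mul, ← Finset.mul_sum]; ring
      _ ≤ _ := by gcongr
  have q4 : ∑ a ∈ F, ∑ b ∈ G, 4 * C * (4 ^ b * t b) *
      cutoff 2 (1 / √d * 2 ^ a) ≤ 4 * C * (4 * n) * 4 := by
    rw [Finset.sum_comm]
    simp only [← Finset.mul_sum]
    calc _ ≤ ∑ b ∈ G, 4 * C * (4 ^ b * t b) * (2 * 2) := by
          refine Finset.sum_le_sum fun b _ => mul_le_mul_of_nonneg_left ?_
            (mul_nonneg (by positivity) (hy b))
          exact sum_ite_mul_two_pow_le F (by positivity) (by positivity)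
      _ = 4 * C * (∑ b ∈ G, (4 ^ b * t b)) * 4 := by
          rw [← Finset.sum_mul, ← Finset.mul_sum]; ring
      _ ≤ _ := by gcongr
  have q5 : ∑ a ∈ F, 2 * (4 ^ a * s a) *
      ∑ b ∈ G, cutoff 4 (√d / 2 ^ a / 2 ^ b) ≤ 2 * (4 * n) * 8 := by
    calc _ ≤ ∑ a ∈ F, 2 * (4 ^ a * s a) * (2 * 4) := by
          refine Finset.sum_le_sum fun a _ => mul_le_mul_of_nonneg_left ?_
            (mul_nonneg (by positivity) (hx a))
          exact sum_ite_div_two_pow_le G (by positivity) (by positivity)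
      _ = 2 * (∑ a ∈ F, (4 ^ a * s a)) * 8 := by rw [← Finset.sum_mul, ← Finset.mul_sum]; ring
      _ ≤ _ := by gcongr
  have q1' : 4 * Real.exp 2 / n * ∑ a ∈ F, (4 ^ a * s a) * ∑ b ∈ G, (4 ^ b * t b)
      ≤ 64 * Real.exp 2 * n := by
    rw [← Finset.sum_mul]
    calc _ ≤ 4 * Real.exp 2 / n * (4 * n * (4 * n)) := by gcongr
      _ = _ := by field_simp; ring
  calc _ ≤ √d * ((64 * Real.exp 2 + 8 * τ + 96 * C + 64) * n) := by
        refine mul_le_mul_of_nonneg_left ?_ (by positivity)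
        linarith
    _ = _ := by ring

/-! ### Discrepancy and the heavy pairs. -/

/-- The total weight `∑_{i ∈ S, j ∈ T} A i j` between two sets of vertices. -/
def weightBetween {n : ℕ} (A : Matrix (Fin n) (Fin n) ℝ) (S T : Finset (Fin n)) : ℝ :=
  ∑ i ∈ S, ∑ j ∈ T, A i j

/-- The discrepancy property: between sets `S`, `T` of vertices with `|S| ≤ |T|` the weight is either
of the order of `d |S| |T| / n`, or it exceeds this value by a controlled amount. -/
def HasDiscrepancy {n : ℕ} (A : Matrix (Fin n) (Fin n) ℝ) (d C : ℝ) : Prop :=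
  ∀ S T : Finset (Fin n), S.Nonempty → S.card ≤ T.card →
    weightBetween A S T ≤ Real.exp 2 * (d * S.card * T.card / n) ∨
    weightBetween A S T * Real.log (weightBetween A S T / (d * S.card * T.card / n)) ≤
      C * (T.card * Real.log (Real.exp 1 * n / T.card))

/-- The indices `i` with `2 ^ a ≤ |k i| < 2 ^ (a + 1)`. -/
def dyadicLevel {n : ℕ} (k : Fin n → ℤ) (a : ℕ) : Finset (Fin n) :=
  Finset.univ.filter fun i => k i ≠ 0 ∧ Nat.log 2 (k i).natAbs = a

theorem abs_bounds_of_mem_dyadicLevel {n : ℕ} {k : Fin n → ℤ} {a : ℕ} {i : Fin n}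
    (h : i ∈ dyadicLevel k a) : (2 : ℝ) ^ a ≤ |(k i : ℝ)| ∧ |(k i : ℝ)| < 2 * 2 ^ a := by
  obtain ⟨h0, h1⟩ := (Finset.mem_filter.1 h).2
  have h2 := Nat.pow_log_le_self 2 (Int.natAbs_ne_zero.2 h0)
  have h3 := Nat.lt_pow_succ_log_self one_lt_two (k i).natAbs
  rw [h1] at h2 h3
  have h4 : ((k i).natAbs : ℝ) = |(k i : ℝ)| := by
    rw [Nat.cast_natAbs, Int.cast_abs]
  rw [← h4]
  rw [pow_succ, mul_comm] at h3
  exact ⟨by exact_mod_cast h2, by exact_mod_cast h3⟩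

theorem sum_four_pow_mul_card_dyadicLevel_le {n : ℕ} (k : Fin n → ℤ) (F : Finset ℕ) :
    ∑ a ∈ F, (4 : ℝ) ^ a * (dyadicLevel k a).card ≤ ∑ i, (k i : ℝ) ^ 2 := by
  calc ∑ a ∈ F, (4 : ℝ) ^ a * (dyadicLevel k a).card
      ≤ ∑ a ∈ F, ∑ i, if i ∈ dyadicLevel k a then (k i : ℝ) ^ 2 else 0 := by
        refine Finset.sum_le_sum fun a _ => ?_
        rw [← Finset.sum_filter, Finset.filter_univ_mem, mul_comm, ← nsmul_eq_mul]
        refine Finset.card_nsmul_le_sum _ _ _ fun i hi => ?_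
        rw [← sq_abs, show (4 : ℝ) = 2 ^ 2 by norm_num, pow_right_comm]
        gcongr
        exact (abs_bounds_of_mem_dyadicLevel hi).1
    _ = ∑ i, ∑ a ∈ F, if i ∈ dyadicLevel k a then (k i : ℝ) ^ 2 else 0 := Finset.sum_comm
    _ ≤ ∑ i, (k i : ℝ) ^ 2 := by
        refine Finset.sum_le_sum fun i _ => ?_
        calc _ ≤ ∑ a ∈ F, if Nat.log 2 (k i).natAbs = a then (k i : ℝ) ^ 2 else 0 := by
              refine Finset.sum_le_sum fun a _ => ?_
              split_ifs with h1 h2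
              · exact le_rfl
              · exact absurd (Finset.mem_filter.1 h1).2.2 h2
              · positivity
              · exact le_rfl
          _ ≤ _ := by
              rw [Finset.sum_ite_eq]
              split_ifs
              · exact le_rfl
              · positivity

theorem sum_eq_sum_dyadicLevel {n : ℕ} (k : Fin n → ℤ) (g : Fin n → ℝ)
    (hg : ∀ i, k i = 0 → g i = 0) :
    ∑ i, g i = ∑ a ∈ Finset.univ.image (fun i => Nat.log 2 (k i).natAbs),
      ∑ i ∈ dyadicLevel k a, g i := by
  rw [← Finset.sum_fiberwise_of_maps_to (s := Finset.univ)
    (t := Finset.univ.image (fun i => Nat.log 2 (k i).natAbs))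
    (g := fun i => Nat.log 2 (k i).natAbs)
    (fun i _ => Finset.mem_image_of_mem _ (Finset.mem_univ i))]
  refine Finset.sum_congr rfl fun a _ => (Finset.sum_subset ?_ ?_).symm
  · intro i hi
    exact Finset.mem_filter.2 ⟨Finset.mem_univ i, (Finset.mem_filter.1 hi).2.2⟩
  · intro i hi hi'
    refine hg i ?_
    by_contra h
    exact hi' (Finset.mem_filter.2 ⟨Finset.mem_univ i, h, (Finset.mem_filter.1 hi).2⟩)

open Classical in
/-- The contribution to `kᵀ A l` of the pairs of indices with large `|k i * l j|`. -/
theorem heavy_sum_le {n : ℕ} (hn : 0 < n) {d τ C : ℝ} (hd : 0 < d) (hτ : 0 ≤ τ) (hC : 0 ≤ C)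
    {A : Matrix (Fin n) (Fin n) ℝ} (hA : ∀ i j, 0 ≤ A i j) (hsymm : ∀ i j, A i j = A j i)
    (hdisc : HasDiscrepancy A d C) (k l : Fin n → ℤ)
    (hk : ∑ i, (k i : ℝ) ^ 2 ≤ 4 * n) (hl : ∑ i, (l i : ℝ) ^ 2 ≤ 4 * n)
    (hkI : ∀ i, k i ≠ 0 → ∑ j, A i j ≤ τ * d) (hlI : ∀ i, l i ≠ 0 → ∑ j, A i j ≤ τ * d) :
    ∑ i, ∑ j, (if √d < |(k i : ℝ) * l j| then |(k i : ℝ) * l j| * A i j else 0) ≤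
      8 * (64 * Real.exp 2 + 8 * τ + 96 * C + 64) * n * √d := by
  set f : Fin n → Fin n → ℝ :=
    fun i j => if √d < |(k i : ℝ) * l j| then |(k i : ℝ) * l j| * A i j else 0 with hf
  set F := Finset.univ.image (fun i => Nat.log 2 (k i).natAbs)
  set G := Finset.univ.image (fun i => Nat.log 2 (l i).natAbs)
  have hsum : ∑ i, ∑ j, f i j = ∑ a ∈ F, ∑ b ∈ G,
      ∑ i ∈ dyadicLevel k a, ∑ j ∈ dyadicLevel l b, f i j := by
    rw [sum_eq_sum_dyadicLevel k]
    · refine Finset.sum_congr rfl fun a _ => ?_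
      refine (Finset.sum_congr rfl fun i _ => ?_).trans Finset.sum_comm
      refine sum_eq_sum_dyadicLevel l (f i) fun j hj => ?_
      simp [hf, hj]
    · intro i hi
      simp [hf, hi]
  -- The discrepancy property requires the smaller set first, so `P` fixes the order of
  -- cardinalities; the opposite order is treated with `k` and `l` exchanged, by symmetry of `A`.
  let P : (Fin n → ℤ) → (Fin n → ℤ) → ℕ → ℕ → Prop := fun k l a b =>
    √d < 4 * 2 ^ (a + b) ∧ 0 < (dyadicLevel k a).card ∧ 0 < (dyadicLevel l b).card ∧
      (dyadicLevel k a).card ≤ (dyadicLevel l b).card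
  have hw0 : ∀ S T, 0 ≤ weightBetween A S T := fun S T =>
    Finset.sum_nonneg fun i _ => Finset.sum_nonneg fun j _ => hA i j
  have hwsymm : ∀ S T, weightBetween A S T = weightBetween A T S := fun S T => by
    refine (Finset.sum_comm (s := S) (t := T) (f := fun i j => A i j)).trans ?_
    exact Finset.sum_congr rfl fun i _ => Finset.sum_congr rfl fun j _ => hsymm _ _
  have main : ∀ k l : Fin n → ℤ, ∑ i, (k i : ℝ) ^ 2 ≤ 4 * n → ∑ i, (l i : ℝ) ^ 2 ≤ 4 * n →
      (∀ i, k i ≠ 0 → ∑ j, A i j ≤ τ * d) → ∀ F G : Finset ℕ,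
      ∑ a ∈ F, ∑ b ∈ G, (if P k l a b then
        2 ^ (a + b) * weightBetween A (dyadicLevel k a) (dyadicLevel l b) else 0) ≤
      (64 * Real.exp 2 + 8 * τ + 96 * C + 64) * n * √d := by
    intro k l hk hl hkI F G
    refine sum_level_pairs_le F G (P k l) (fun a => (dyadicLevel k a).card)
      (fun b => (dyadicLevel l b).card)
      (fun a b => weightBetween A (dyadicLevel k a) (dyadicLevel l b))
      (by exact_mod_cast hn) hd hτ hC (fun _ => by positivity) (fun _ => by positivity)
      ((sum_four_pow_mul_card_dyadicLevel_le k F).trans hk)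
      ((sum_four_pow_mul_card_dyadicLevel_le l G).trans hl) ?_
    rintro a b ⟨h1, h2, h3, h4⟩
    refine ⟨by exact_mod_cast h2, by exact_mod_cast h3, h1, ?_,
      hdisc _ _ (Finset.card_pos.1 h2) h4⟩
    calc weightBetween A (dyadicLevel k a) (dyadicLevel l b)
        ≤ ∑ i ∈ dyadicLevel k a, τ * d := by
          refine Finset.sum_le_sum fun i hi => ?_
          refine le_trans ?_ (hkI i (Finset.mem_filter.1 hi).2.1)
          exact Finset.sum_le_univ_sum_of_nonneg fun j => hA i j
      _ = τ * d * (dyadicLevel k a).card := by rw [Finset.sum_const, nsmul_eq_mul]; ring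
  -- The factor 4 is the product of the two dyadic upper ends; the two orders of cardinality turn it
  -- into the 8 of the conclusion.
  have hpair : ∀ a b, ∑ i ∈ dyadicLevel k a, ∑ j ∈ dyadicLevel l b, f i j ≤
      4 * (if P k l a b then
        2 ^ (a + b) * weightBetween A (dyadicLevel k a) (dyadicLevel l b) else 0) +
      4 * (if P l k b a then
        2 ^ (b + a) * weightBetween A (dyadicLevel l b) (dyadicLevel k a) else 0) := by
    intro a b
    have hz : ∀ (p : Prop) [Decidable p] (x : ℝ), 0 ≤ x → 0 ≤ 4 * (if p then x else 0) := by
      intro p _ x hx; split_ifs <;> simp [hx]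
    have h1 := hz (P k l a b) (2 ^ (a + b) * weightBetween A (dyadicLevel k a) (dyadicLevel l b))
      (mul_nonneg (by positivity) (hw0 _ _))
    have h2 := hz (P l k b a) (2 ^ (b + a) * weightBetween A (dyadicLevel l b) (dyadicLevel k a))
      (mul_nonneg (by positivity) (hw0 _ _))
    rcases (dyadicLevel k a).eq_empty_or_nonempty with hka | hka
    · have h3 : ∑ i ∈ dyadicLevel k a, ∑ j ∈ dyadicLevel l b, f i j = 0 := by simp [hka]
      linarith
    rcases (dyadicLevel l b).eq_empty_or_nonempty with hlb | hlb
    · have h3 : ∑ i ∈ dyadicLevel k a, ∑ j ∈ dyadicLevel l b, f i j = 0 := by simp [hlb]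
      linarith
    have hlt : ∀ i ∈ dyadicLevel k a, ∀ j ∈ dyadicLevel l b,
        |(k i : ℝ) * l j| ≤ 4 * 2 ^ (a + b) := by
      intro i hi j hj
      rw [abs_mul, pow_add]
      calc |(k i : ℝ)| * |(l j : ℝ)| ≤ (2 * 2 ^ a) * (2 * 2 ^ b) :=
            mul_le_mul (abs_bounds_of_mem_dyadicLevel hi).2.le
              (abs_bounds_of_mem_dyadicLevel hj).2.le (abs_nonneg _) (by positivity)
        _ = _ := by ring
    by_cases hh : √d < 4 * 2 ^ (a + b)
    · have h3 : ∑ i ∈ dyadicLevel k a, ∑ j ∈ dyadicLevel l b, f i j ≤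
          4 * (2 ^ (a + b) * weightBetween A (dyadicLevel k a) (dyadicLevel l b)) := by
        unfold weightBetween
        rw [← mul_assoc, Finset.mul_sum]
        refine Finset.sum_le_sum fun i hi => ?_
        rw [Finset.mul_sum]
        refine Finset.sum_le_sum fun j hj => ?_
        simp only [hf]
        split_ifs
        · exact mul_le_mul_of_nonneg_right (hlt i hi j hj) (hA i j)
        · exact mul_nonneg (by positivity) (hA i j)
      rcases le_total (dyadicLevel k a).card (dyadicLevel l b).card with hc | hc
      · rw [if_pos (show P k l a b from ⟨hh, hka.card_pos, hlb.card_pos, hc⟩)]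
        linarith
      · rw [if_pos (show P l k b a from ⟨by rwa [add_comm], hlb.card_pos, hka.card_pos, hc⟩)]
        rw [hwsymm (dyadicLevel l b), add_comm b a]
        linarith
    · have h3 : ∑ i ∈ dyadicLevel k a, ∑ j ∈ dyadicLevel l b, f i j = 0 := by
        refine Finset.sum_eq_zero fun i hi => Finset.sum_eq_zero fun j hj => ?_
        exact if_neg fun h => hh (h.trans_le (hlt i hi j hj))
      rw [h3]; linarith
  rw [hsum]
  calc _ ≤ ∑ a ∈ F, ∑ b ∈ G, (4 * (if P k l a b then
        2 ^ (a + b) * weightBetween A (dyadicLevel k a) (dyadicLevel l b) else 0) +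
      4 * (if P l k b a then
        2 ^ (b + a) * weightBetween A (dyadicLevel l b) (dyadicLevel k a) else 0)) :=
        Finset.sum_le_sum fun a _ => Finset.sum_le_sum fun b _ => hpair a b
    _ = 4 * (∑ a ∈ F, ∑ b ∈ G, (if P k l a b then
        2 ^ (a + b) * weightBetween A (dyadicLevel k a) (dyadicLevel l b) else 0)) +
      4 * (∑ b ∈ G, ∑ a ∈ F, (if P l k b a then
        2 ^ (b + a) * weightBetween A (dyadicLevel l b) (dyadicLevel k a) else 0)) := by
        simp only [Finset.sum_add_distrib, ← Finset.mul_sum]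
        congr 2
        exact Finset.sum_comm
    _ ≤ _ := by
        have h1 := main k l hk hl hkI F G
        have h2 := main l k hl hk hlI G F
        linarith

/-! ### Reduction of the spectral norm to integer vectors. -/

/-- Rounding the coordinates of `z` according to the signs of those of `v`. -/
theorem exists_int_vector_dominating {n : ℕ} (z v : Fin n → ℝ) (hz : ∑ i, z i ^ 2 ≤ n) :
    ∃ k : Fin n → ℤ, ∑ i, (k i : ℝ) ^ 2 ≤ 4 * n ∧ ∑ i, z i * v i ≤ ∑ i, k i * v i := by
  -- Rounding moves each coordinate by less than 1, so squares become at most `2 * z i ^ 2 + 2`,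
  -- with total at most `2 n + 2 n`.
  refine ⟨fun i => if 0 ≤ v i then ⌈z i⌉ else ⌊z i⌋, ?_, Finset.sum_le_sum fun i _ => ?_⟩
  · calc _ ≤ ∑ i, (2 * z i ^ 2 + 2) := by
          refine Finset.sum_le_sum fun i _ => ?_
          dsimp only
          split_ifs
          · nlinarith [Int.le_ceil (z i), Int.ceil_lt_add_one (z i),
              sq_nonneg (z i - (⌈z i⌉ - z i)), sq_nonneg (2 * z i - ⌈z i⌉)]
          · nlinarith [Int.floor_le (z i), Int.lt_floor_add_one (z i),
              sq_nonneg (2 * z i - ⌊z i⌋)]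
      _ ≤ _ := by
          rw [Finset.sum_add_distrib, ← Finset.mul_sum]
          simp
          linarith
  · dsimp only
    split_ifs with h
    · exact mul_le_mul_of_nonneg_right (Int.le_ceil _) h
    · exact mul_le_mul_of_nonpos_right (Int.floor_le _) (not_le.1 h).le

/-- The form is linear in each vector separately, so the vectors can be rounded one after the other,
each time in the direction that increases the form. Unlike in a net argument, there is no
approximation error to absorb. -/
theorem matrixSpectralNorm_le_of_int_vectors {n : ℕ} (hn : 0 < n) (B : Matrix (Fin n) (Fin n) ℝ)
    {c : ℝ} (hc : 0 ≤ c)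
    (h : ∀ k l : Fin n → ℤ, ∑ i, (k i : ℝ) ^ 2 ≤ 4 * n → ∑ i, (l i : ℝ) ^ 2 ≤ 4 * n →
      ∑ i, ∑ j, (k i : ℝ) * l j * B i j ≤ c * n) :
    matrixSpectralNorm B ≤ c := by
  have hreal : ∀ z y : Fin n → ℝ, ∑ i, z i ^ 2 ≤ n → ∑ i, y i ^ 2 ≤ n →
      ∑ i, ∑ j, z i * y j * B i j ≤ c * n := by
    intro z y hz hy
    obtain ⟨k, hk, hk'⟩ := exists_int_vector_dominating z (fun i => ∑ j, y j * B i j) hz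
    obtain ⟨l, hl, hl'⟩ := exists_int_vector_dominating y (fun j => ∑ i, k i * B i j) hy
    calc ∑ i, ∑ j, z i * y j * B i j = ∑ i, z i * ∑ j, y j * B i j := by
          simp only [Finset.mul_sum, mul_assoc]
      _ ≤ ∑ i, k i * ∑ j, y j * B i j := hk'
      _ = ∑ j, y j * ∑ i, k i * B i j := by
          simp only [Finset.mul_sum]
          rw [Finset.sum_comm]
          exact Finset.sum_congr rfl fun _ _ => Finset.sum_congr rfl fun _ _ => by ring
      _ ≤ ∑ j, l j * ∑ i, k i * B i j := hl'
      _ = ∑ i, ∑ j, (k i : ℝ) * l j * B i j := by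
          simp only [Finset.mul_sum]
          rw [Finset.sum_comm]
          exact Finset.sum_congr rfl fun _ _ => Finset.sum_congr rfl fun _ _ => by ring
      _ ≤ c * n := h k l hk hl
  refine ContinuousLinearMap.opNorm_le_of_re_inner_le hc fun x y hx hy => ?_
  have hn' : (0 : ℝ) < n := by exact_mod_cast hn
  have hs := hreal (fun i => √n * y i) (fun i => √n * x i) ?_ ?_
  · have : ∑ i, ∑ j, √n * y i * (√n * x j) * B i j
        = n * inner ℝ (Matrix.toEuclideanCLM (n := Fin n) (𝕜 := ℝ) B x) y := by
      rw [PiLp.inner_apply]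
      simp only [Matrix.ofLp_toEuclideanCLM, Matrix.mulVec, dotProduct, Finset.mul_sum,
        RCLike.inner_apply, conj_trivial]
      refine Finset.sum_congr rfl fun i _ => Finset.sum_congr rfl fun j _ => ?_
      have := Real.mul_self_sqrt hn'.le
      linear_combination (y i * x j * B i j) * this
    rw [this, mul_comm c] at hs
    simpa using le_of_mul_le_mul_left hs hn'
  all_goals
    simp only [mul_pow, Real.sq_sqrt hn'.le, ← Finset.mul_sum]
    first
    | rw [← EuclideanSpace.real_norm_sq_eq, hy]; simp
    | rw [← EuclideanSpace.real_norm_sq_eq, hx]; simp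

/-- The integer vectors of dimension `n` with squared Euclidean norm at most `4 n`. -/
noncomputable def intNet (n : ℕ) : Finset (Fin n → ℤ) :=
  (Fintype.piFinset fun _ => Finset.Icc (-(4 * n : ℤ)) (4 * n)).filter
    fun k => ∑ i, k i ^ 2 ≤ 4 * n

/-- The box in `intNet` only ensures finiteness: integers satisfy `|k i| ≤ k i ^ 2 ≤ 4 n`. -/
theorem mem_intNet {n : ℕ} {k : Fin n → ℤ} : k ∈ intNet n ↔ ∑ i, (k i : ℝ) ^ 2 ≤ 4 * n := by
  have hcast : ∑ i, (k i : ℝ) ^ 2 ≤ 4 * n ↔ ∑ i, k i ^ 2 ≤ 4 * (n : ℤ) := by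
    rw [← @Int.cast_le ℝ]; push_cast; rfl
  rw [hcast, intNet, Finset.mem_filter, and_iff_right_iff_imp]
  intro h
  refine Fintype.mem_piFinset.2 fun i => Finset.mem_Icc.2 (abs_le.1 ?_)
  have h1 : k i ^ 2 ≤ ∑ i, k i ^ 2 :=
    Finset.single_le_sum (f := fun i => k i ^ 2) (fun i _ => sq_nonneg _) (Finset.mem_univ i)
  have h2 : |k i| ≤ |k i| ^ 2 := by
    rcases (abs_nonneg (k i)).eq_or_lt with h | h
    · rw [← h]; norm_num
    · nlinarith
  rw [sq_abs] at h2
  linarith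

theorem sum_two_pow_neg_natAbs_le (R : ℕ) :
    ∑ j ∈ Finset.Icc (-(R : ℤ)) R, (1 / 2 : ℝ) ^ j.natAbs ≤ 3 := by
  suffices h : ∑ j ∈ Finset.Icc (-(R : ℤ)) R, (1 / 2 : ℝ) ^ j.natAbs = 3 - 2 * (1 / 2) ^ R by
    rw [h]; have : (0 : ℝ) ≤ (1 / 2) ^ R := by positivity
    linarith
  induction R with
  | zero => norm_num
  | succ R ih =>
    have h : Finset.Icc (-((R + 1 : ℕ) : ℤ)) ((R + 1 : ℕ) : ℤ)
        = insert (-((R + 1 : ℕ) : ℤ)) (insert ((R + 1 : ℕ) : ℤ) (Finset.Icc (-(R : ℤ)) R)) := by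
      ext j; simp only [Finset.mem_Icc, Finset.mem_insert]; omega
    rw [h, Finset.sum_insert, Finset.sum_insert, ih, Int.natAbs_neg, Int.natAbs_natCast, pow_succ]
    · ring
    · simp only [Finset.mem_Icc]; omega
    · simp only [Finset.mem_Icc, Finset.mem_insert]; omega

/-- On the net the Gaussian weight `exp (4 n - ∑ k i ^ 2)` is at least 1, and its sum over the whole
box factors into one-dimensional sums, each at most `3 ≤ exp 2`. -/
theorem card_intNet_le (n : ℕ) : ((intNet n).card : ℝ) ≤ Real.exp (6 * n) := by
  have hexp : ∀ j : ℤ, Real.exp (-(j : ℝ) ^ 2) ≤ (1 / 2 : ℝ) ^ j.natAbs := by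
    intro j
    have h1 : (2 : ℝ) ≤ Real.exp 1 := by linarith [Real.exp_one_gt_d9]
    have h2 : (j.natAbs : ℝ) ≤ (j : ℝ) ^ 2 := by
      have : j.natAbs ≤ j.natAbs ^ 2 := Nat.le_self_pow (by norm_num) _
      have h3 : ((j.natAbs : ℝ)) ^ 2 = (j : ℝ) ^ 2 := by
        rw [Nat.cast_natAbs, Int.cast_abs, sq_abs]
      rw [← h3]; exact_mod_cast this
    rw [Real.exp_neg, one_div, inv_pow]
    refine inv_anti₀ (by positivity) ?_
    calc (2 : ℝ) ^ j.natAbs ≤ Real.exp 1 ^ j.natAbs := by gcongr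
      _ = Real.exp j.natAbs := by rw [← Real.exp_nat_mul, mul_one]
      _ ≤ _ := Real.exp_le_exp.2 h2
  have h3 : (3 : ℝ) ≤ Real.exp 2 := by linarith [Real.add_one_le_exp (2 : ℝ)]
  calc ((intNet n).card : ℝ) = ∑ k ∈ intNet n, (1 : ℝ) := by simp
    _ ≤ ∑ k ∈ intNet n, Real.exp (4 * n) * ∏ i, Real.exp (-(k i : ℝ) ^ 2) := by
        refine Finset.sum_le_sum fun k hk => ?_
        rw [← Real.exp_sum, ← Real.exp_add, Finset.sum_neg_distrib]
        exact Real.one_le_exp (by linarith [mem_intNet.1 hk])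
    _ ≤ ∑ k ∈ Fintype.piFinset fun _ : Fin n => Finset.Icc (-(4 * n : ℤ)) (4 * n),
          Real.exp (4 * n) * ∏ i, Real.exp (-(k i : ℝ) ^ 2) :=
        Finset.sum_le_sum_of_subset_of_nonneg (Finset.filter_subset _ _)
          fun _ _ _ => by positivity
    _ = Real.exp (4 * n) *
          (∑ j ∈ Finset.Icc (-(4 * n : ℤ)) (4 * n), Real.exp (-(j : ℝ) ^ 2)) ^ n := by
        rw [← Finset.mul_sum, Finset.sum_prod_piFinset (Finset.Icc (-(4 * n : ℤ)) (4 * n))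
          (fun _ j => Real.exp (-(j : ℝ) ^ 2))]
        simp
    _ ≤ Real.exp (4 * n) * Real.exp 2 ^ n := by
        gcongr
        refine (Finset.sum_le_sum fun j _ => hexp j).trans (le_trans ?_ h3)
        have := sum_two_pow_neg_natAbs_le (4 * n)
        push_cast at this
        exact this
    _ = Real.exp (6 * n) := by
        rw [← Real.exp_nat_mul, ← Real.exp_add]; congr 1; ring

/-! ### Decomposition of the adjacency matrix into cliques. -/

/-- The sets of vertices that can be hyperedges. -/
abbrev PossibleEdge (M n : ℕ) := {e : Finset (Fin n) // 2 ≤ e.card ∧ e.card ≤ M}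

/-- The probability of the hyperedge `e`. -/
noncomputable def edgeProb {n : ℕ} (w : Finset (Fin n) → ℝ) (e : Finset (Fin n)) : ℝ :=
  w e / (n.choose (e.card - 1) : ℝ)

/-- The adjacency matrix of the complete graph on the vertices of `e`. -/
def cliqueMatrix {n : ℕ} (e : Finset (Fin n)) (i j : Fin n) : ℝ :=
  if i ≠ j ∧ i ∈ e ∧ j ∈ e then 1 else 0

theorem cliqueMatrix_nonneg {n : ℕ} (e : Finset (Fin n)) (i j : Fin n) :
    0 ≤ cliqueMatrix e i j := by
  unfold cliqueMatrix
  split_ifs <;> norm_num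

theorem cliqueMatrix_sq {n : ℕ} (e : Finset (Fin n)) (i j : Fin n) :
    cliqueMatrix e i j ^ 2 = cliqueMatrix e i j := by
  unfold cliqueMatrix
  split_ifs <;> norm_num

theorem sum_cliqueMatrix_le {n M : ℕ} {e : Finset (Fin n)} (he : e.card ≤ M) :
    ∑ i, ∑ j, cliqueMatrix e i j ≤ (M : ℝ) ^ 2 := by
  calc ∑ i, ∑ j, cliqueMatrix e i j
      ≤ ∑ i, ∑ j, (if i ∈ e then (1 : ℝ) else 0) * (if j ∈ e then (1 : ℝ) else 0) := by
        refine Finset.sum_le_sum fun i _ => Finset.sum_le_sum fun j _ => ?_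
        unfold cliqueMatrix
        split_ifs with h1 h2 h3 <;> simp_all
    _ = (e.card : ℝ) ^ 2 := by
        rw [← Finset.sum_mul_sum]; simp [sq]
    _ ≤ _ := by gcongr

theorem sum_powersetCard_eq_sum_possibleEdge {M n : ℕ} (g : Finset (Fin n) → ℝ) :
    ∑ m ∈ Finset.Icc 2 M, ∑ e ∈ Finset.powersetCard m (Finset.univ : Finset (Fin n)), g e =
      ∑ e : PossibleEdge M n, g e := by
  rw [← Finset.sum_subtype (Finset.univ.filter fun e : Finset (Fin n) => 2 ≤ e.card ∧ e.card ≤ M)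
    (by simp) g]
  rw [← Finset.sum_fiberwise_of_maps_to (t := Finset.Icc 2 M) (g := Finset.card)
    (fun e he => by simpa using he)]
  refine Finset.sum_congr rfl fun m hm => Finset.sum_congr ?_ fun _ _ => rfl
  ext e
  simp only [Finset.mem_powersetCard, Finset.mem_filter, Finset.mem_univ, true_and,
    Finset.subset_univ]
  constructor
  · rintro rfl; exact ⟨Finset.mem_Icc.1 hm, rfl⟩
  · exact fun h => h.2

theorem sum_mul_sum_cliqueMatrix {M n : ℕ} (W : Fin n → Fin n → ℝ) (g : PossibleEdge M n → ℝ) :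
    ∑ i, ∑ j, W i j * ∑ e : PossibleEdge M n, cliqueMatrix e.1 i j * g e =
      ∑ e : PossibleEdge M n, (∑ i, ∑ j, W i j * cliqueMatrix e.1 i j) * g e := by
  simp only [Finset.mul_sum, Finset.sum_mul, ← mul_assoc]
  refine (Finset.sum_congr rfl fun i _ => Finset.sum_comm).trans ?_
  exact Finset.sum_comm

theorem hyperAdjMatrix_eq_sum {M n : ℕ} (H : Set (Finset (Fin n))) (i j : Fin n) :
    hyperAdjMatrix M H i j = ∑ e : PossibleEdge M n, cliqueMatrix e.1 i j * adjTensor H e := by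
  rw [← sum_powersetCard_eq_sum_possibleEdge fun e => cliqueMatrix e i j * adjTensor H e]
  simp only [hyperAdjMatrix, Matrix.of_apply, cliqueMatrix]
  split_ifs with h
  · simp [h]
  · simp [h, Finset.sum_filter]

theorem adjTensor_nonneg {n : ℕ} (H : Set (Finset (Fin n))) (e : Finset (Fin n)) :
    0 ≤ adjTensor H e := Set.indicator_nonneg (fun _ _ => zero_le_one) _

theorem hyperAdjMatrix_nonneg {M n : ℕ} (H : Set (Finset (Fin n))) (i j : Fin n) :
    0 ≤ hyperAdjMatrix M H i j := by
  rw [hyperAdjMatrix_eq_sum]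
  exact Finset.sum_nonneg fun e _ => mul_nonneg (cliqueMatrix_nonneg _ _ _) (adjTensor_nonneg _ _)

theorem hyperAdjMatrix_symm {M n : ℕ} (H : Set (Finset (Fin n))) (i j : Fin n) :
    hyperAdjMatrix M H i j = hyperAdjMatrix M H j i := by
  simp only [hyperAdjMatrix_eq_sum, cliqueMatrix]
  refine Finset.sum_congr rfl fun e _ => ?_
  congr 2
  rw [ne_comm, and_comm (a := i ∈ e.1)]

theorem card_filter_pair_le {n m : ℕ} {i j : Fin n} (hij : i ≠ j) :
    ((Finset.powersetCard m (Finset.univ : Finset (Fin n))).filter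
      (fun e => i ∈ e ∧ j ∈ e)).card ≤ (n - 2).choose (m - 2) := by
  have hc : ({i, j} : Finset (Fin n))ᶜ.card = n - 2 := by
    rw [Finset.card_compl, Finset.card_pair hij, Fintype.card_fin]
  rw [← hc, ← Finset.card_powersetCard]
  refine Finset.card_le_card_of_injOn (fun e => e \ {i, j}) ?_ ?_
  · intro e he
    simp only [Finset.coe_filter, Finset.mem_powersetCard, Set.mem_ofPred_eq] at he
    rw [Finset.mem_coe, Finset.mem_powersetCard]
    constructor
    · intro x hx
      simp only [Finset.mem_sdiff] at hx
      simpa using hx.2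
    · rw [Finset.card_sdiff_of_subset, Finset.card_pair hij, he.1.2]
      intro x hx
      rcases Finset.mem_insert.1 hx with rfl | hx
      · exact he.2.1
      · rw [Finset.mem_singleton.1 hx]; exact he.2.2
  · intro e he e' he' h
    simp only [Finset.coe_filter, Finset.mem_powersetCard, Set.mem_ofPred_eq] at he he'
    ext x
    have := Finset.ext_iff.1 h x
    simp only [Finset.mem_sdiff, Finset.mem_insert, Finset.mem_singleton] at this
    by_cases h1 : x = i
    · subst h1; exact iff_of_true he.2.1 he'.2.1
    by_cases h2 : x = j
    · subst h2; exact iff_of_true he.2.2 he'.2.2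
    simpa [h1, h2] using this

/-- Enlarge the numerator to `(n - 1).choose (m - 2)` and use the absorption identity `n * (n -
1).choose (m - 2) = (m - 1) * n.choose (m - 1)`. -/
theorem choose_sub_two_div_choose_le {n m : ℕ} (hm : 2 ≤ m) (hmn : m ≤ n) :
    ((n - 2).choose (m - 2) : ℝ) / (n.choose (m - 1) : ℝ) ≤ ((m : ℝ) - 1) / n := by
  obtain ⟨m, rfl⟩ := Nat.exists_eq_add_of_le' hm
  obtain ⟨n, rfl⟩ := Nat.exists_eq_add_of_le' (hm.trans hmn)
  have hpos : (0 : ℝ) < ((n + 2).choose (m + 1) : ℝ) := by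
    exact_mod_cast Nat.choose_pos (by omega)
  simp only [Nat.add_sub_cancel, show m + 2 - 1 = m + 1 by omega]
  rw [div_le_div_iff₀ hpos (by positivity)]
  have h1 : n.choose m ≤ (n + 1).choose m := Nat.choose_le_choose m (Nat.le_succ n)
  have h2 := Nat.add_one_mul_choose_eq (n + 1) m
  have h3 : n.choose m * (n + 2) ≤ (n + 2).choose (m + 1) * (m + 1) := by
    rw [← h2, mul_comm]; gcongr
  have h4 : (n.choose m : ℝ) * (n + 2) ≤ ((n + 2).choose (m + 1) : ℝ) * (m + 1) := by
    exact_mod_cast h3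
  push_cast
  linarith

theorem adjTensor_eq_indicator {Ω : Type*} {n : ℕ} (H : Ω → Set (Finset (Fin n)))
    (e : Finset (Fin n)) (ω : Ω) :
    adjTensor (H ω) e = {ω | e ∈ H ω}.indicator (fun _ => (1 : ℝ)) ω := by
  simp [adjTensor, Set.indicator]

/-! ### Expectations and exponential moments. -/

section Hypergraph

variable {Ω : Type*} [MeasurableSpace Ω] {μ : Measure Ω} {n M : ℕ}
  {w : Finset (Fin n) → ℝ} {H : Ω → Set (Finset (Fin n))}

namespace IsInhomogeneousHypergraph

theorem edgeProb_nonneg (hH : IsInhomogeneousHypergraph μ M w H) (e : PossibleEdge M n) :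
    0 ≤ edgeProb w e := by
  unfold edgeProb
  rw [← hH.prob_mem e e.2.1 e.2.2]
  exact measureReal_nonneg

theorem measurable_adjTensor (hH : IsInhomogeneousHypergraph μ M w H) (e : Finset (Fin n)) :
    Measurable fun ω => adjTensor (H ω) e := by
  simp only [adjTensor_eq_indicator]
  exact measurable_const.indicator (hH.measurableSet_mem e)

theorem integral_comp_adjTensor [IsProbabilityMeasure μ] (hH : IsInhomogeneousHypergraph μ M w H) (e : PossibleEdge M n)
    (φ : ℝ → ℝ) :
    ∫ ω, φ (adjTensor (H ω) e) ∂μ = φ 0 + edgeProb w e * (φ 1 - φ 0) := by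
  have h : ∀ ω, φ (adjTensor (H ω) e) =
      φ 0 + {ω | e.1 ∈ H ω}.indicator (fun _ => φ 1 - φ 0) ω := by
    intro ω
    by_cases h : e.1 ∈ H ω <;> simp [adjTensor, h]
  simp only [h]
  rw [integral_add (integrable_const _)
    ((integrable_const _).indicator (hH.measurableSet_mem e)),
    integral_indicator_const _ (hH.measurableSet_mem e), hH.prob_mem e e.2.1 e.2.2]
  simp [edgeProb]

theorem integrable_adjTensor [IsProbabilityMeasure μ] (hH : IsInhomogeneousHypergraph μ M w H) (e : Finset (Fin n)) :
    Integrable (fun ω => adjTensor (H ω) e) μ := by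
  simp only [adjTensor_eq_indicator]
  exact (integrable_const _).indicator (hH.measurableSet_mem e)

theorem expectedMatrix_eq_sum [IsProbabilityMeasure μ] (hH : IsInhomogeneousHypergraph μ M w H) (i j : Fin n) :
    expectedMatrix μ (fun ω => hyperAdjMatrix M (H ω)) i j =
      ∑ e : PossibleEdge M n, cliqueMatrix e.1 i j * edgeProb w e := by
  simp only [expectedMatrix, Matrix.of_apply, hyperAdjMatrix_eq_sum]
  rw [integral_finsetSum _ fun (e : PossibleEdge M n) _ =>
    (hH.integrable_adjTensor e.1).const_mul (cliqueMatrix e.1 i j)]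
  refine Finset.sum_congr rfl fun e _ => ?_
  rw [integral_const_mul, hH.integral_comp_adjTensor e fun x => x]
  ring

/-- **Chernoff bound** for a weighted number of hyperedges. -/
theorem measureReal_le_sum_adjTensor [IsProbabilityMeasure μ]
    (hH : IsInhomogeneousHypergraph μ M w H)
    (c : PossibleEdge M n → ℝ) (ε : ℝ) :
    μ.real {ω | ε ≤ ∑ e : PossibleEdge M n, c e * adjTensor (H ω) e} ≤
      Real.exp (-ε + ∑ e : PossibleEdge M n, edgeProb w e * (Real.exp (c e) - 1)) := by
  set X : PossibleEdge M n → Ω → ℝ := fun e ω => c e * adjTensor (H ω) e with hX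
  have hmeas : ∀ e, Measurable (X e) := fun e => (hH.measurable_adjTensor e).const_mul _
  have hind : iIndepFun X μ := by
    have h1 := (hH.indep.iIndepFun_indicator (β := ℝ)).comp (fun (e : PossibleEdge M n) x => c e * x)
      (fun e => measurable_const_mul _)
    convert h1 using 2 with e
    ext ω
    simp only [hX, adjTensor_eq_indicator, Function.comp]
  have hsum : (fun ω => ∑ e : PossibleEdge M n, c e * adjTensor (H ω) e) = ∑ e, X e := by
    ext ω; simp [hX, Finset.sum_apply]
  have hbd : ∀ ω, ‖Real.exp (1 * ∑ e : PossibleEdge M n, c e * adjTensor (H ω) e)‖ ≤ Real.exp (∑ e : PossibleEdge M n, |c e|) := by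
    intro ω
    rw [Real.norm_eq_abs, Real.abs_exp, one_mul]
    refine Real.exp_le_exp.2 (Finset.sum_le_sum fun e _ => ?_)
    by_cases h : e.1 ∈ H ω <;> simp [adjTensor, h, le_abs_self]
  have hint : Integrable (fun ω => Real.exp (1 * ∑ e : PossibleEdge M n, c e * adjTensor (H ω) e)) μ := by
    refine Integrable.of_bound (Measurable.aestronglyMeasurable ?_) _
      (Filter.Eventually.of_forall hbd)
    exact Real.measurable_exp.comp ((Finset.measurable_fun_sum _ fun e _ => hmeas e).const_mul _)
  -- The exponential parameter is 1, since any scaling can be put into `c`.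
  refine (measure_ge_le_exp_mul_mgf ε zero_le_one hint).trans ?_
  rw [hsum, hind.mgf_sum hmeas, Real.exp_add, neg_one_mul, Real.exp_sum]
  gcongr with e
  · exact fun e _ => mgf_nonneg
  · rw [mgf]
    simp only [hX, one_mul]
    rw [hH.integral_comp_adjTensor e fun x => Real.exp (c e * x)]
    simp only [mul_zero, mul_one, Real.exp_zero]
    linarith [Real.add_one_le_exp (edgeProb w e * (Real.exp (c e) - 1))]

/-- No sign of `w` is assumed: it is inherited from the probabilities, the binomial denominators
being positive. -/
theorem maxWeight_nonneg (hH : IsInhomogeneousHypergraph μ M w H) {m : ℕ} (hm : 2 ≤ m)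
    (hM : m ≤ M) : 0 ≤ maxWeight w m := by
  refine Real.iSup_nonneg fun e => ?_
  have h := hH.edgeProb_nonneg ⟨e.1, by rw [e.2]; exact ⟨hm, hM⟩⟩
  have hpos : (0 : ℝ) < (n.choose (e.1.card - 1) : ℝ) := by
    have : e.1.card ≤ n := by simpa using Finset.card_le_univ e.1
    exact_mod_cast Nat.choose_pos (by omega)
  unfold edgeProb at h
  simpa [hpos.ne'] using mul_nonneg h hpos.le

theorem degreeParam_nonneg (hH : IsInhomogeneousHypergraph μ M w H) : 0 ≤ degreeParam M w := by
  refine Finset.sum_nonneg fun m hm => ?_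
  obtain ⟨h1, h2⟩ := Finset.mem_Icc.1 hm
  have : (2 : ℝ) ≤ m := by exact_mod_cast h1
  exact mul_nonneg (by linarith) (hH.maxWeight_nonneg h1 h2)

theorem expectedMatrix_nonneg [IsProbabilityMeasure μ] (hH : IsInhomogeneousHypergraph μ M w H) (i j : Fin n) :
    0 ≤ expectedMatrix μ (fun ω => hyperAdjMatrix M (H ω)) i j := by
  rw [hH.expectedMatrix_eq_sum]
  exact Finset.sum_nonneg fun e _ => mul_nonneg (cliqueMatrix_nonneg _ _ _) (hH.edgeProb_nonneg e)

/-- At most `(n - 2).choose (m - 2)` sets of size `m` contain a given pair, each of probability at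
most `d_m / n.choose (m - 1)`. Size `m` thus contributes at most `(m - 1) * d_m / n`, which explains
the weights in `degreeParam`. -/
theorem expectedMatrix_le [IsProbabilityMeasure μ] (hH : IsInhomogeneousHypergraph μ M w H) (i j : Fin n) :
    expectedMatrix μ (fun ω => hyperAdjMatrix M (H ω)) i j ≤ degreeParam M w / n := by
  rcases eq_or_ne i j with rfl | hij
  · rw [hH.expectedMatrix_eq_sum]
    simp only [cliqueMatrix, ne_eq, not_true, false_and, if_false, zero_mul, Finset.sum_const_zero]
    exact div_nonneg hH.degreeParam_nonneg (Nat.cast_nonneg n)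
  rw [hH.expectedMatrix_eq_sum,
    ← sum_powersetCard_eq_sum_possibleEdge fun e => cliqueMatrix e i j * edgeProb w e,
    degreeParam, Finset.sum_div]
  refine Finset.sum_le_sum fun m hm => ?_
  obtain ⟨h1, h2⟩ := Finset.mem_Icc.1 hm
  have hmax := hH.maxWeight_nonneg h1 h2
  have h1' : (2 : ℝ) ≤ m := by exact_mod_cast h1
  rcases lt_or_ge n m with hmn | hmn
  · rw [Finset.powersetCard_eq_empty.2 (by simpa using hmn), Finset.sum_empty]
    exact div_nonneg (mul_nonneg (by linarith) hmax) (Nat.cast_nonneg n)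
  calc ∑ e ∈ Finset.powersetCard m Finset.univ, cliqueMatrix e i j * edgeProb w e
      = ∑ e ∈ (Finset.powersetCard m (Finset.univ : Finset (Fin n))).filter
          (fun e => i ∈ e ∧ j ∈ e), edgeProb w e := by
        rw [Finset.sum_filter]
        refine Finset.sum_congr rfl fun e _ => ?_
        simp [cliqueMatrix, hij]
    _ ≤ ((Finset.powersetCard m (Finset.univ : Finset (Fin n))).filter
          (fun e => i ∈ e ∧ j ∈ e)).card • (maxWeight w m / (n.choose (m - 1) : ℝ)) := by
        refine Finset.sum_le_card_nsmul _ _ _ fun e he => ?_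
        have hc := (Finset.mem_powersetCard.1 (Finset.mem_filter.1 he).1).2
        rw [edgeProb, hc]
        gcongr
        exact le_ciSup (f := fun e : {e : Finset (Fin n) // e.card = m} => w e)
          (Set.finite_range _).bddAbove ⟨e, hc⟩
    _ ≤ ((n - 2).choose (m - 2) : ℝ) * (maxWeight w m / (n.choose (m - 1) : ℝ)) := by
        rw [nsmul_eq_mul]
        gcongr
        exact card_filter_pair_le hij
    _ = maxWeight w m * (((n - 2).choose (m - 2) : ℝ) / (n.choose (m - 1) : ℝ)) := by ring
    _ ≤ maxWeight w m * (((m : ℝ) - 1) / n) := by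
        refine mul_le_mul_of_nonneg_left ?_ hmax
        exact choose_sub_two_div_choose_le h1 hmn
    _ = _ := by ring

end IsInhomogeneousHypergraph
end Hypergraph

/-! ### Concentration of the light pairs, uniformly over integer vectors. -/

/-- The coefficients `k i * l j` of a bilinear form, those of absolute value above `b` removed. -/
noncomputable def lightPart {n : ℕ} (b : ℝ) (k l : Fin n → ℤ) (i j : Fin n) : ℝ :=
  if |(k i : ℝ) * l j| ≤ b then (k i : ℝ) * l j else 0

theorem abs_lightPart_le {n : ℕ} {b : ℝ} (hb : 0 ≤ b) (k l : Fin n → ℤ) (i j : Fin n) :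
    |lightPart b k l i j| ≤ b := by
  unfold lightPart
  split_ifs with h
  · exact h
  · simpa using hb

theorem lightPart_sq_le {n : ℕ} (b : ℝ) (k l : Fin n → ℤ) (i j : Fin n) :
    lightPart b k l i j ^ 2 ≤ (k i : ℝ) ^ 2 * (l j : ℝ) ^ 2 := by
  unfold lightPart
  split_ifs
  · rw [mul_pow]
  · rw [zero_pow two_ne_zero]; positivity

theorem exp_sub_one_le {x : ℝ} (hx : |x| ≤ 1) : Real.exp x - 1 ≤ x + x ^ 2 := by
  have := (abs_le.1 (Real.abs_exp_sub_one_sub_id_le hx)).2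
  linarith

section Hypergraph

variable {Ω : Type*} [MeasurableSpace Ω] {μ : Measure Ω} [IsProbabilityMeasure μ] {n M : ℕ}
  {w : Finset (Fin n) → ℝ} {H : Ω → Set (Finset (Fin n))}

namespace IsInhomogeneousHypergraph

/-- This is a Bernstein-type estimate. With `r = 1 / (M ^ 2 * √d)` all exponents `r * c e` lie in
`[-1, 1]`, so `exp x - 1 ≤ x + x ^ 2` applies: the linear part is the mean, and the quadratic part
is at most `16 n / M ^ 2 ≤ 4 n`. The threshold contributes `-20 n`. -/
theorem measureReal_light_sum_ge_le (hH : IsInhomogeneousHypergraph μ M w H) (hn : 0 < n)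
    (hM : 2 ≤ M) (hd : 0 < degreeParam M w) {k l : Fin n → ℤ} (hk : k ∈ intNet n)
    (hl : l ∈ intNet n) :
    μ.real {ω | 20 * (M : ℝ) ^ 2 * n * √(degreeParam M w) ≤
      ∑ i, ∑ j, lightPart (√(degreeParam M w)) k l i j * (hyperAdjMatrix M (H ω) -
        expectedMatrix μ (fun ω' => hyperAdjMatrix M (H ω'))) i j} ≤ Real.exp (-(16 * n)) := by
  set d := degreeParam M w with hd'
  set q := √d with hq
  have hq0 : 0 < q := Real.sqrt_pos.2 hd
  have hdq : d = q * q := (Real.mul_self_sqrt hd.le).symm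
  set W := lightPart q k l with hW
  set E := expectedMatrix μ (fun ω' => hyperAdjMatrix M (H ω')) with hE
  have hn' : (0 : ℝ) < n := by exact_mod_cast hn
  have hM' : (2 : ℝ) ≤ M := by exact_mod_cast hM
  set r : ℝ := 1 / ((M : ℝ) ^ 2 * q) with hr
  have hr0 : 0 < r := by positivity
  set c : PossibleEdge M n → ℝ := fun e => ∑ i, ∑ j, W i j * cliqueMatrix e.1 i j with hc
  have hexp : ∑ i, ∑ j, W i j * E i j = ∑ e, c e * edgeProb w e := by
    simp only [hE, hH.expectedMatrix_eq_sum]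
    exact sum_mul_sum_cliqueMatrix W fun e : PossibleEdge M n => edgeProb w e
  have hset : {ω | 20 * (M : ℝ) ^ 2 * n * q ≤ ∑ i, ∑ j, W i j * (hyperAdjMatrix M (H ω) - E) i j} ⊆
      {ω | r * (20 * (M : ℝ) ^ 2 * n * q + ∑ e, c e * edgeProb w e) ≤
        ∑ e : PossibleEdge M n, (r * c e) * adjTensor (H ω) e} := by
    intro ω hω
    simp only [Set.mem_ofPred_eq] at hω ⊢
    have h1 : ∑ i, ∑ j, W i j * (hyperAdjMatrix M (H ω) - E) i j =
        ∑ e : PossibleEdge M n, c e * adjTensor (H ω) e - ∑ e, c e * edgeProb w e := by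
      rw [← hexp, ← sum_mul_sum_cliqueMatrix W fun e : PossibleEdge M n => adjTensor (H ω) e]
      simp only [← hyperAdjMatrix_eq_sum, Matrix.sub_apply, mul_sub, Finset.sum_sub_distrib]
    simp only [mul_assoc r, ← Finset.mul_sum]
    refine mul_le_mul_of_nonneg_left ?_ hr0.le
    linarith
  refine (measureReal_mono hset).trans ((hH.measureReal_le_sum_adjTensor _ _).trans ?_)
  rw [Real.exp_le_exp]
  have hcabs : ∀ e, |r * c e| ≤ 1 := by
    intro e
    have h1 : |c e| ≤ q * (M : ℝ) ^ 2 := by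
      calc |c e| ≤ ∑ i, ∑ j, q * cliqueMatrix e.1 i j := by
            refine (Finset.abs_sum_le_sum_abs _ _).trans (Finset.sum_le_sum fun i _ => ?_)
            refine (Finset.abs_sum_le_sum_abs _ _).trans (Finset.sum_le_sum fun j _ => ?_)
            rw [abs_mul, abs_of_nonneg (cliqueMatrix_nonneg _ _ _)]
            exact mul_le_mul_of_nonneg_right (abs_lightPart_le hq0.le k l i j)
              (cliqueMatrix_nonneg _ _ _)
        _ = q * ∑ i, ∑ j, cliqueMatrix e.1 i j := by simp only [Finset.mul_sum]
        _ ≤ _ := by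
            gcongr
            exact sum_cliqueMatrix_le e.2.2
    rw [abs_mul, abs_of_pos hr0]
    calc r * |c e| ≤ r * (q * (M : ℝ) ^ 2) := by gcongr
      _ = 1 := by rw [hr]; field_simp
  -- Cauchy–Schwarz over the at most `M ^ 2` ordered pairs in `e`; it reduces the variance to a sum
  -- against the entries of `E`.
  have hcsq : ∀ e, c e ^ 2 ≤ (M : ℝ) ^ 2 * ∑ i, ∑ j, W i j ^ 2 * cliqueMatrix e.1 i j := by
    intro e
    simp only [hc, ← Finset.sum_product']
    calc _ = (∑ x ∈ Finset.univ ×ˢ Finset.univ,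
            cliqueMatrix e.1 x.1 x.2 * (W x.1 x.2 * cliqueMatrix e.1 x.1 x.2)) ^ 2 := by
          congr 1
          refine Finset.sum_congr rfl fun x _ => ?_
          rw [mul_left_comm, ← sq, cliqueMatrix_sq]
      _ ≤ _ := Finset.sum_mul_sq_le_sq_mul_sq _ _ _
      _ ≤ _ := by
          simp only [mul_pow, cliqueMatrix_sq]
          refine mul_le_mul_of_nonneg_right ?_ (Finset.sum_nonneg fun x _ =>
            mul_nonneg (sq_nonneg _) (cliqueMatrix_nonneg _ _ _))
          rw [Finset.sum_product' (f := fun i j => cliqueMatrix e.1 i j)]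
          exact sum_cliqueMatrix_le e.2.2
  have hvar : ∑ e, edgeProb w e.1 * c e ^ 2 ≤ 16 * (M : ℝ) ^ 2 * (d * n) := by
    calc ∑ e, edgeProb w e.1 * c e ^ 2
        ≤ ∑ e : PossibleEdge M n,
            edgeProb w e.1 * ((M : ℝ) ^ 2 * ∑ i, ∑ j, W i j ^ 2 * cliqueMatrix e.1 i j) :=
          Finset.sum_le_sum fun e _ => mul_le_mul_of_nonneg_left (hcsq e) (hH.edgeProb_nonneg e)
      _ = (M : ℝ) ^ 2 * ∑ i, ∑ j, W i j ^ 2 * E i j := by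
          simp only [hE, hH.expectedMatrix_eq_sum]
          rw [sum_mul_sum_cliqueMatrix (fun i j => W i j ^ 2)
            fun e : PossibleEdge M n => edgeProb w e, Finset.mul_sum]
          exact Finset.sum_congr rfl fun e _ => by ring
      _ ≤ (M : ℝ) ^ 2 * ∑ i, ∑ j, ((k i : ℝ) ^ 2 * (l j : ℝ) ^ 2) * (d / n) := by
          refine mul_le_mul_of_nonneg_left ?_ (by positivity)
          refine Finset.sum_le_sum fun i _ => Finset.sum_le_sum fun j _ => ?_
          exact mul_le_mul (lightPart_sq_le q k l i j) (hH.expectedMatrix_le i j)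
            (hH.expectedMatrix_nonneg i j) (by positivity)
      _ = (M : ℝ) ^ 2 * (((∑ i, (k i : ℝ) ^ 2) * ∑ j, (l j : ℝ) ^ 2) * (d / n)) := by
          rw [Finset.sum_mul_sum]
          simp only [Finset.sum_mul]
      _ ≤ (M : ℝ) ^ 2 * ((4 * n * (4 * n)) * (d / n)) := by
          gcongr
          · exact mem_intNet.1 hk
          · exact mem_intNet.1 hl
      _ = _ := by field_simp; ring
  have hterm : ∑ e : PossibleEdge M n, edgeProb w e * (Real.exp (r * c e) - 1) ≤
      r * ∑ e, c e * edgeProb w e.1 + r ^ 2 * ∑ e, edgeProb w e.1 * c e ^ 2 := by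
    rw [Finset.mul_sum, Finset.mul_sum, ← Finset.sum_add_distrib]
    refine Finset.sum_le_sum fun e _ => ?_
    calc _ ≤ edgeProb w e.1 * (r * c e + (r * c e) ^ 2) :=
          mul_le_mul_of_nonneg_left (exp_sub_one_le (hcabs e)) (hH.edgeProb_nonneg e)
      _ = _ := by ring
  have h20 : r * (20 * (M : ℝ) ^ 2 * n * q) = 20 * n := by rw [hr]; field_simp
  have h4 : r ^ 2 * ∑ e, edgeProb w e.1 * c e ^ 2 ≤ 4 * n := by
    calc _ ≤ r ^ 2 * (16 * (M : ℝ) ^ 2 * (d * n)) := by gcongr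
      _ = 16 * n / (M : ℝ) ^ 2 := by rw [hr, hdq]; field_simp
      _ ≤ 4 * n := by
          rw [div_le_iff₀ (by positivity)]
          have : (4 : ℝ) ≤ (M : ℝ) ^ 2 := by nlinarith
          nlinarith
  rw [mul_add, h20]
  linarith

theorem measureReal_exists_light_sum_ge_le (hH : IsInhomogeneousHypergraph μ M w H) (hn : 0 < n)
    (hM : 2 ≤ M) (hd : 0 < degreeParam M w) :
    μ.real {ω | ∃ k ∈ intNet n, ∃ l ∈ intNet n, 20 * (M : ℝ) ^ 2 * n * √(degreeParam M w) ≤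
      ∑ i, ∑ j, lightPart (√(degreeParam M w)) k l i j * (hyperAdjMatrix M (H ω) -
        expectedMatrix μ (fun ω' => hyperAdjMatrix M (H ω'))) i j} ≤ Real.exp (-(4 * n)) := by
  set B : (Fin n → ℤ) × (Fin n → ℤ) → Set Ω := fun p =>
    {ω | 20 * (M : ℝ) ^ 2 * n * √(degreeParam M w) ≤
      ∑ i, ∑ j, lightPart (√(degreeParam M w)) p.1 p.2 i j * (hyperAdjMatrix M (H ω) -
        expectedMatrix μ (fun ω' => hyperAdjMatrix M (H ω'))) i j} with hB
  calc _ ≤ μ.real (⋃ p ∈ intNet n ×ˢ intNet n, B p) := by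
        refine measureReal_mono ?_ (measure_ne_top _ _)
        rintro ω ⟨k, hk, l, hl, h⟩
        exact Set.mem_biUnion (x := (k, l)) (Finset.mem_product.2 ⟨hk, hl⟩) h
    _ ≤ ∑ p ∈ intNet n ×ˢ intNet n, μ.real (B p) := measureReal_biUnion_finset_le _ _
    _ ≤ ∑ p ∈ intNet n ×ˢ intNet n, Real.exp (-(16 * n)) := by
        refine Finset.sum_le_sum fun p hp => ?_
        obtain ⟨h1, h2⟩ := Finset.mem_product.1 hp
        exact hH.measureReal_light_sum_ge_le hn hM hd h1 h2
    _ = ((intNet n).card : ℝ) * (intNet n).card * Real.exp (-(16 * n)) := by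
        rw [Finset.sum_const, Finset.card_product, nsmul_eq_mul]; push_cast; ring
    _ ≤ Real.exp (6 * n) * Real.exp (6 * n) * Real.exp (-(16 * n)) := by
        gcongr <;> exact card_intNet_le n
    _ = _ := by rw [← Real.exp_add, ← Real.exp_add]; congr 1; ring

end IsInhomogeneousHypergraph
end Hypergraph

/-! ### The discrepancy property with high probability. -/

/-- An upper bound for the logarithm of the number of sets of at most `t` among `n` points. -/
noncomputable def logEntropy (n t : ℕ) : ℝ := t * Real.log (Real.exp 1 * n / t)

/-- Each set counted has weight `(t / n) ^ S.card ≥ (t / n) ^ t`, while the total weight of all sets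
is `(1 + t / n) ^ n ≤ exp t`. -/
theorem card_filter_card_le_le_exp_logEntropy {n t : ℕ} (ht : 0 < t) (htn : t ≤ n) :
    ((Finset.univ.filter fun S : Finset (Fin n) => S.card ≤ t).card : ℝ) ≤
      Real.exp (logEntropy n t) := by
  have ht' : (0 : ℝ) < t := by exact_mod_cast ht
  have hn' : (0 : ℝ) < n := by exact_mod_cast ht.trans_le htn
  have htn' : (t : ℝ) ≤ n := by exact_mod_cast htn
  have hle : (t : ℝ) / n ≤ 1 := (div_le_one hn').2 htn'
  have h1 : Real.exp (logEntropy n t) = Real.exp t / (t / n) ^ t := by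
    rw [logEntropy, Real.exp_nat_mul, Real.exp_log (by positivity), ← Real.exp_one_pow t, ← div_pow]
    congr 1
    field_simp
  rw [h1, le_div_iff₀ (by positivity)]
  calc ((Finset.univ.filter fun S : Finset (Fin n) => S.card ≤ t).card : ℝ) * (t / n) ^ t
      = ∑ S ∈ Finset.univ.filter fun S : Finset (Fin n) => S.card ≤ t, ((t : ℝ) / n) ^ t := by
        rw [Finset.sum_const, nsmul_eq_mul]
    _ ≤ ∑ S ∈ Finset.univ.filter fun S : Finset (Fin n) => S.card ≤ t, ((t : ℝ) / n) ^ S.card := by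
        refine Finset.sum_le_sum fun S hS => ?_
        exact pow_le_pow_of_le_one (by positivity) hle (Finset.mem_filter.1 hS).2
    _ ≤ ∑ S : Finset (Fin n), ((t : ℝ) / n) ^ S.card :=
        Finset.sum_le_sum_of_subset_of_nonneg (Finset.filter_subset _ _)
          fun _ _ _ => by positivity
    _ = (t / n + 1) ^ n := by
        have := Finset.sum_pow_mul_eq_add_pow ((t : ℝ) / n) 1 (Finset.univ : Finset (Fin n))
        simpa using this
    _ ≤ Real.exp (t / n) ^ n := by
        gcongr
        exact Real.add_one_le_exp _
    _ = Real.exp t := by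
        rw [← Real.exp_nat_mul]; congr 1; field_simp

/-- The `n` singletons are among the sets counted by the entropy bound, so no monotonicity in `t`
has to be studied. -/
theorem log_le_logEntropy {n t : ℕ} (ht : 0 < t) (htn : t ≤ n) : Real.log n ≤ logEntropy n t := by
  have hn : (0 : ℝ) < n := by exact_mod_cast ht.trans_le htn
  rw [Real.log_le_iff_le_exp hn]
  refine le_trans ?_ (card_filter_card_le_le_exp_logEntropy ht htn)
  have h : (Finset.univ.map ⟨fun i : Fin n => ({i} : Finset (Fin n)),
      Finset.singleton_injective⟩).card ≤
      (Finset.univ.filter fun S : Finset (Fin n) => S.card ≤ t).card := by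
    refine Finset.card_le_card fun S hS => ?_
    obtain ⟨i, -, rfl⟩ := Finset.mem_map.1 hS
    simpa using Nat.one_le_iff_ne_zero.2 ht.ne'
  rw [Finset.card_map, Finset.card_univ, Fintype.card_fin] at h
  exact_mod_cast h

/-- The least admissible value serves as a deterministic threshold: a violation of discrepancy
forces the weight to reach it, so a single tail bound covers the whole event. -/
theorem exists_isLeast_mul_log {m R v : ℝ} (hm : 0 < m) (hv : Real.exp 2 * m ≤ v)
    (hR : R ≤ v * Real.log (v / m)) :
    ∃ u, IsLeast {v | Real.exp 2 * m ≤ v ∧ R ≤ v * Real.log (v / m)} u := by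
  have hcont : ContinuousOn (fun v => v * Real.log (v / m)) (Set.Ici (Real.exp 2 * m)) := by
    refine continuousOn_id.mul (ContinuousOn.log (continuousOn_id.div_const m) fun x hx => ?_)
    have : 0 < x := lt_of_lt_of_le (by positivity) (Set.mem_Ici.1 hx)
    exact (div_pos this hm).ne'
  have hclosed : IsClosed {v | Real.exp 2 * m ≤ v ∧ R ≤ v * Real.log (v / m)} :=
    hcont.preimage_isClosed_of_isClosed isClosed_Ici (isClosed_Ici (a := R))
  exact ⟨_, hclosed.isLeast_csInf ⟨v, hv, hR⟩ ⟨Real.exp 2 * m, fun x hx => hx.1⟩⟩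

section Hypergraph

variable {Ω : Type*} [MeasurableSpace Ω] {μ : Measure Ω} [IsProbabilityMeasure μ] {n M : ℕ}
  {w : Finset (Fin n) → ℝ} {H : Ω → Set (Finset (Fin n))}

namespace IsInhomogeneousHypergraph

/-- A Chernoff bound with parameter `log x / M ^ 2`. Since one hyperedge contributes `b e ≤ M ^ 2`,
Bernoulli's inequality linearizes `x ^ (b e / M ^ 2)`, and the exponential moments cost at most `u /
M ^ 2`. As `log x ≥ 2`, this is at most half of the gain; hence the 2 in the denominator. -/
theorem measureReal_weightBetween_ge_le (hH : IsInhomogeneousHypergraph μ M w H) (hM : 2 ≤ M)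
    (S T : Finset (Fin n)) {m u : ℝ} (hm : 0 < m) (hm' : m = degreeParam M w * S.card * T.card / n)
    (hu : Real.exp 2 * m ≤ u) :
    μ.real {ω | u ≤ weightBetween (hyperAdjMatrix M (H ω)) S T} ≤
      Real.exp (-(u * Real.log (u / m) / (2 * (M : ℝ) ^ 2))) := by
  have hM' : (2 : ℝ) ≤ M := by exact_mod_cast hM
  set Q : ℝ := (M : ℝ) ^ 2 with hQ
  have hQ0 : 0 < Q := by positivity
  have hu0 : 0 < u := lt_of_lt_of_le (by positivity) hu
  set x := u / m with hx
  have hx2 : Real.exp 2 ≤ x := by rwa [hx, le_div_iff₀ hm]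
  have hx0 : 0 < x := by positivity
  have hlog : 2 ≤ Real.log x := by rwa [Real.le_log_iff_exp_le hx0]
  set W : Fin n → Fin n → ℝ := fun i j => (if i ∈ S then 1 else 0) * (if j ∈ T then 1 else 0)
    with hW
  have hWsum : ∀ A : Matrix (Fin n) (Fin n) ℝ,
      weightBetween A S T = ∑ i, ∑ j, W i j * A i j := by
    intro A
    simp [weightBetween, hW]
  have hW0 : ∀ i j, 0 ≤ W i j := fun i j => by simp only [hW]; split_ifs <;> norm_num
  have hW1 : ∀ i j, W i j ≤ 1 := fun i j => by simp only [hW]; split_ifs <;> norm_num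
  set b : PossibleEdge M n → ℝ := fun e => ∑ i, ∑ j, W i j * cliqueMatrix e.1 i j with hb
  have hb0 : ∀ e, 0 ≤ b e := fun e => Finset.sum_nonneg fun i _ => Finset.sum_nonneg fun j _ =>
    mul_nonneg (hW0 i j) (cliqueMatrix_nonneg _ _ _)
  have hbQ : ∀ e, b e ≤ Q := fun e => by
    refine le_trans ?_ (sum_cliqueMatrix_le e.2.2)
    exact Finset.sum_le_sum fun i _ => Finset.sum_le_sum fun j _ =>
      mul_le_of_le_one_left (cliqueMatrix_nonneg _ _ _) (hW1 i j)
  have hbm : ∑ e, b e * edgeProb w e.1 ≤ m := by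
    rw [← sum_mul_sum_cliqueMatrix W fun e : PossibleEdge M n => edgeProb w e]
    simp only [← hH.expectedMatrix_eq_sum]
    calc _ ≤ ∑ i, ∑ j, W i j * (degreeParam M w / n) :=
          Finset.sum_le_sum fun i _ => Finset.sum_le_sum fun j _ =>
            mul_le_mul_of_nonneg_left (hH.expectedMatrix_le i j) (hW0 i j)
      _ = (∑ i, ∑ j, W i j) * (degreeParam M w / n) := by simp only [Finset.sum_mul]
      _ = m := by
          simp only [hW]
          rw [← Finset.sum_mul_sum]
          simp [hm']
          ring
  set r := Real.log x / Q with hr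
  have hr0 : 0 < r := by positivity
  have hset : {ω | u ≤ weightBetween (hyperAdjMatrix M (H ω)) S T} ⊆
      {ω | r * u ≤ ∑ e : PossibleEdge M n, (r * b e) * adjTensor (H ω) e} := by
    intro ω hω
    simp only [Set.mem_ofPred_eq] at hω ⊢
    rw [hWsum] at hω
    simp only [hyperAdjMatrix_eq_sum] at hω
    rw [sum_mul_sum_cliqueMatrix W fun e : PossibleEdge M n => adjTensor (H ω) e] at hω
    simp only [mul_assoc r, ← Finset.mul_sum]
    exact mul_le_mul_of_nonneg_left hω hr0.le
  refine (measureReal_mono hset).trans ((hH.measureReal_le_sum_adjTensor _ _).trans ?_)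
  rw [Real.exp_le_exp]
  have hx1 : 1 ≤ x := (Real.one_le_exp (by norm_num)).trans hx2
  have hexp : ∀ e, Real.exp (r * b e) - 1 ≤ b e * ((x - 1) / Q) := by
    intro e
    have h1 := rpow_one_add_le_one_add_mul_self (s := x - 1) (by linarith) (p := b e / Q)
      (div_nonneg (hb0 e) hQ0.le) ((div_le_one hQ0).2 (hbQ e))
    rw [add_sub_cancel, Real.rpow_def_of_pos hx0] at h1
    have h2 : Real.log x * (b e / Q) = r * b e := by rw [hr]; ring
    rw [h2] at h1
    calc _ ≤ b e / Q * (x - 1) := by linarith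
      _ = _ := by ring
  have h1 : ∑ e : PossibleEdge M n, edgeProb w e * (Real.exp (r * b e) - 1) ≤ u / Q := by
    calc _ ≤ ∑ e : PossibleEdge M n, edgeProb w e * (b e * ((x - 1) / Q)) :=
          Finset.sum_le_sum fun e _ => mul_le_mul_of_nonneg_left (hexp e) (hH.edgeProb_nonneg e)
      _ = (∑ e, b e * edgeProb w e.1) * ((x - 1) / Q) := by
          rw [Finset.sum_mul]
          exact Finset.sum_congr rfl fun e _ => by ring
      _ ≤ m * ((x - 1) / Q) := by
          refine mul_le_mul_of_nonneg_right hbm (div_nonneg (by linarith) hQ0.le)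
      _ = (u - m) / Q := by rw [hx]; field_simp
      _ ≤ u / Q := by gcongr; linarith
  have h2 : u / Q ≤ u * Real.log x / (2 * Q) := by
    rw [div_le_div_iff₀ hQ0 (by positivity)]
    have : u * 2 ≤ u * Real.log x := by gcongr
    nlinarith
  have h3 : r * u = 2 * (u * Real.log x / (2 * Q)) := by rw [hr]; field_simp
  linarith

/-- The constant provides `K + 3` entropies of the larger set. One pays for the choice of `S`, one
for the choice of `T`, and `K + 1` remain, each at least `log n`; the sum over the `n` possible
sizes of `T` uses up one more factor `n`. -/
theorem measureReal_not_hasDiscrepancy_le (hH : IsInhomogeneousHypergraph μ M w H) (hn : 0 < n)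
    (hM : 2 ≤ M) (hd : 0 < degreeParam M w) {K : ℝ} (hK : 0 < K) :
    μ.real {ω | ¬ HasDiscrepancy (hyperAdjMatrix M (H ω)) (degreeParam M w)
      (2 * (M : ℝ) ^ 2 * (K + 3))} ≤ (n : ℝ) ^ (-K) := by
  have hn' : (0 : ℝ) < n := by exact_mod_cast hn
  have hM' : (2 : ℝ) ≤ M := by exact_mod_cast hM
  set d := degreeParam M w with hd'
  set C := 2 * (M : ℝ) ^ 2 * (K + 3) with hC
  set B : Finset (Fin n) → Finset (Fin n) → Set Ω := fun S T =>
    {ω | ¬ (weightBetween (hyperAdjMatrix M (H ω)) S T ≤ Real.exp 2 * (d * S.card * T.card / n) ∨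
      weightBetween (hyperAdjMatrix M (H ω)) S T *
        Real.log (weightBetween (hyperAdjMatrix M (H ω)) S T / (d * S.card * T.card / n)) ≤
      C * (T.card * Real.log (Real.exp 1 * n / T.card)))} with hB
  have hpair : ∀ S T, S.Nonempty → S.card ≤ T.card →
      μ.real (B S T) ≤ Real.exp (-((K + 3) * logEntropy n T.card)) := by
    intro S T hS hST
    have hs : (0 : ℝ) < S.card := by exact_mod_cast hS.card_pos
    have ht : (0 : ℝ) < T.card := by exact_mod_cast hS.card_pos.trans_le hST
    set m := d * S.card * T.card / n with hm
    have hm0 : 0 < m := by positivity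
    rcases (B S T).eq_empty_or_nonempty with h | ⟨ω₀, h₀⟩
    · rw [h, measureReal_empty]; positivity
    simp only [hB, Set.mem_ofPred_eq, not_or, not_le] at h₀
    obtain ⟨u, ⟨hu1, hu2⟩, hu3⟩ := exists_isLeast_mul_log hm0 h₀.1.le h₀.2.le
    have hsub : B S T ⊆ {ω | u ≤ weightBetween (hyperAdjMatrix M (H ω)) S T} := by
      intro ω hω
      simp only [hB, Set.mem_ofPred_eq, not_or, not_le] at hω
      exact hu3 ⟨hω.1.le, hω.2.le⟩
    refine (measureReal_mono hsub).trans
      ((hH.measureReal_weightBetween_ge_le hM S T hm0 hm hu1).trans ?_)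
    rw [Real.exp_le_exp, neg_le_neg_iff, le_div_iff₀ (by positivity)]
    calc _ = C * (T.card * Real.log (Real.exp 1 * n / T.card)) := by rw [hC, logEntropy]; ring
      _ ≤ _ := hu2
  set 𝒯 := (Finset.univ.filter fun T : Finset (Fin n) => T.Nonempty)
  set 𝒮 : ℕ → Finset (Finset (Fin n)) := fun t =>
    (Finset.univ.filter fun S : Finset (Fin n) => S.card ≤ t)
  have hcardn : ∀ T : Finset (Fin n), T.card ≤ n := fun T => by simpa using Finset.card_le_univ T
  have hinner : ∀ T ∈ 𝒯, μ.real (⋃ S ∈ (𝒮 T.card).filter Finset.Nonempty, B S T) ≤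
      Real.exp (-((K + 2) * logEntropy n T.card)) := by
    intro T hT
    have hT0 := (Finset.mem_filter.1 hT).2.card_pos
    calc _ ≤ ∑ S ∈ (𝒮 T.card).filter Finset.Nonempty, μ.real (B S T) :=
          measureReal_biUnion_finset_le _ _
      _ ≤ ∑ S ∈ (𝒮 T.card).filter Finset.Nonempty, Real.exp (-((K + 3) * logEntropy n T.card)) := by
          refine Finset.sum_le_sum fun S hS => ?_
          obtain ⟨h1, h2⟩ := Finset.mem_filter.1 hS
          exact hpair S T h2 (Finset.mem_filter.1 h1).2
      _ ≤ ∑ S ∈ 𝒮 T.card, Real.exp (-((K + 3) * logEntropy n T.card)) :=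
          Finset.sum_le_sum_of_subset_of_nonneg (Finset.filter_subset _ _)
            fun _ _ _ => by positivity
      _ = (𝒮 T.card).card * Real.exp (-((K + 3) * logEntropy n T.card)) := by
          rw [Finset.sum_const, nsmul_eq_mul]
      _ ≤ Real.exp (logEntropy n T.card) * Real.exp (-((K + 3) * logEntropy n T.card)) := by
          gcongr
          exact card_filter_card_le_le_exp_logEntropy hT0 (hcardn T)
      _ = _ := by rw [← Real.exp_add]; congr 1; ring
  calc _ ≤ μ.real (⋃ T ∈ 𝒯, ⋃ S ∈ (𝒮 T.card).filter Finset.Nonempty, B S T) := by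
        refine measureReal_mono ?_ (measure_ne_top _ _)
        intro ω hω
        simp only [HasDiscrepancy, Set.mem_ofPred_eq, not_forall] at hω
        obtain ⟨S, T, hS, hST, h⟩ := hω
        have hT : T.Nonempty := Finset.card_pos.1 (hS.card_pos.trans_le hST)
        refine Set.mem_biUnion (x := T) (Finset.mem_filter.2 ⟨Finset.mem_univ _, hT⟩) ?_
        exact Set.mem_biUnion (x := S) (Finset.mem_filter.2
          ⟨Finset.mem_filter.2 ⟨Finset.mem_univ _, hST⟩, hS⟩) h
    _ ≤ ∑ T ∈ 𝒯, μ.real (⋃ S ∈ (𝒮 T.card).filter Finset.Nonempty, B S T) :=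
        measureReal_biUnion_finset_le _ _
    _ ≤ ∑ T ∈ 𝒯, Real.exp (-((K + 2) * logEntropy n T.card)) := Finset.sum_le_sum hinner
    _ = ∑ t ∈ Finset.Icc 1 n, ∑ T ∈ 𝒯.filter (fun T => T.card = t),
          Real.exp (-((K + 2) * logEntropy n T.card)) := by
        refine (Finset.sum_fiberwise_of_maps_to (fun T hT => ?_) _).symm
        exact Finset.mem_Icc.2 ⟨(Finset.mem_filter.1 hT).2.card_pos, hcardn T⟩
    _ ≤ ∑ t ∈ Finset.Icc 1 n, (n : ℝ) ^ (-(K + 1)) := by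
        refine Finset.sum_le_sum fun t ht => ?_
        obtain ⟨ht0, htn⟩ := Finset.mem_Icc.1 ht
        calc _ = ∑ T ∈ 𝒯.filter (fun T => T.card = t),
              Real.exp (-((K + 2) * logEntropy n t)) :=
              Finset.sum_congr rfl fun T hT => by rw [(Finset.mem_filter.1 hT).2]
          _ ≤ ∑ T ∈ 𝒮 t, Real.exp (-((K + 2) * logEntropy n t)) := by
              refine Finset.sum_le_sum_of_subset_of_nonneg (fun T hT => ?_)
                fun _ _ _ => by positivity
              exact Finset.mem_filter.2 ⟨Finset.mem_univ _, (Finset.mem_filter.1 hT).2.le⟩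
          _ = (𝒮 t).card * Real.exp (-((K + 2) * logEntropy n t)) := by
              rw [Finset.sum_const, nsmul_eq_mul]
          _ ≤ Real.exp (logEntropy n t) * Real.exp (-((K + 2) * logEntropy n t)) := by
              gcongr
              exact card_filter_card_le_le_exp_logEntropy ht0 htn
          _ = Real.exp (-((K + 1) * logEntropy n t)) := by rw [← Real.exp_add]; congr 1; ring
          _ ≤ Real.exp (-((K + 1) * Real.log n)) := by
              gcongr
              exact log_le_logEntropy ht0 htn
          _ = _ := by rw [Real.rpow_def_of_pos hn']; congr 1; ring
    _ = n * (n : ℝ) ^ (-(K + 1)) := by simp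
    _ = (n : ℝ) ^ (-K) := by
        rw [show -K = 1 + -(K + 1) by ring, Real.rpow_add hn', Real.rpow_one]

end IsInhomogeneousHypergraph
end Hypergraph

/-! ### Deterministic norm bound and conclusion. -/

open Classical in
/-- The regularized matrix `A - E` has norm of order `√d` as soon as `A` has the discrepancy property
and the light pairs of indices contribute little. -/
theorem matrixSpectralNorm_regularize_le {n : ℕ} (hn : 0 < n) {d τ C L : ℝ} (hd : 0 < d)
    (hτ : 0 ≤ τ) (hC : 0 ≤ C) (hL : 0 ≤ L) {A E : Matrix (Fin n) (Fin n) ℝ}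
    (hA : ∀ i j, 0 ≤ A i j) (hsymm : ∀ i j, A i j = A j i) (hE0 : ∀ i j, 0 ≤ E i j)
    (hE : ∀ i j, E i j ≤ d / n) (hdisc : HasDiscrepancy A d C)
    (hlight : ∀ k ∈ intNet n, ∀ l ∈ intNet n,
      ∑ i, ∑ j, lightPart (√d) k l i j * (A - E) i j ≤ L * n * √d) :
    matrixSpectralNorm (regularize (A - E) {i | rowSum A i ≤ τ * d}) ≤
      (L + 16 + 8 * (64 * Real.exp 2 + 8 * τ + 96 * C + 64)) * √d := by
  have hn' : (0 : ℝ) < n := by exact_mod_cast hn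
  set q := √d with hq
  have hq0 : 0 < q := Real.sqrt_pos.2 hd
  have hdq : d = q * q := (Real.mul_self_sqrt hd.le).symm
  set I : Set (Fin n) := {i | rowSum A i ≤ τ * d} with hI
  refine matrixSpectralNorm_le_of_int_vectors hn _ (by positivity) fun k₀ l₀ hk₀ hl₀ => ?_
  -- Restricting both vectors to `I` replaces the regularization and ensures that every nonzero
  -- coordinate belongs to a row of bounded degree.
  have hrestrict : ∀ k : Fin n → ℤ, ∑ i, (k i : ℝ) ^ 2 ≤ 4 * n →
      ∑ i, ((if i ∈ I then k i else 0 : ℤ) : ℝ) ^ 2 ≤ 4 * n := by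
    intro k hk
    refine (Finset.sum_le_sum fun i _ => ?_).trans hk
    split_ifs
    · exact le_rfl
    · simpa using sq_nonneg (k i : ℝ)
  have hk := hrestrict k₀ hk₀
  have hl := hrestrict l₀ hl₀
  set k : Fin n → ℤ := fun i => if i ∈ I then k₀ i else 0 with hkdef
  set l : Fin n → ℤ := fun i => if i ∈ I then l₀ i else 0 with hldef
  have heq : ∑ i, ∑ j, (k₀ i : ℝ) * l₀ j * regularize (A - E) I i j =
      ∑ i, ∑ j, (k i : ℝ) * l j * (A - E) i j := by
    refine Finset.sum_congr rfl fun i _ => Finset.sum_congr rfl fun j _ => ?_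
    simp only [regularize, Matrix.of_apply, hkdef, hldef]
    by_cases hi : i ∈ I <;> by_cases hj : j ∈ I <;> simp [hi, hj]
  have hheavy := heavy_sum_le hn hd hτ hC hA hsymm hdisc k l hk hl
    (fun i hi => by by_contra h; exact hi (if_neg h))
    (fun i hi => by by_contra h; exact hi (if_neg h))
  rw [← hq] at hheavy
  have hexp : ∑ i, ∑ j, (if q < |(k i : ℝ) * l j| then |(k i : ℝ) * l j| * E i j else 0) ≤
      16 * n * q := by
    calc _ ≤ ∑ i, ∑ j, ((k i : ℝ) ^ 2 * (l j : ℝ) ^ 2) * (q / n) := by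
          refine Finset.sum_le_sum fun i _ => Finset.sum_le_sum fun j _ => ?_
          split_ifs with h
          · rw [← mul_pow, ← sq_abs]
            generalize |(k i : ℝ) * l j| = x at h
            -- On heavy pairs `q < x`, so one factor `q` of `d = q * q` can be exchanged for `x`.
            calc x * E i j ≤ x * (d / n) :=
                  mul_le_mul_of_nonneg_left (hE i j) (hq0.trans h).le
              _ = x * q * (q / n) := by rw [hdq]; ring
              _ ≤ x ^ 2 * (q / n) := by
                  rw [sq]
                  have : 0 < x := hq0.trans h
                  gcongr
          · positivity
      _ = ((∑ i, (k i : ℝ) ^ 2) * ∑ j, (l j : ℝ) ^ 2) * (q / n) := by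
          rw [Finset.sum_mul_sum]
          simp only [Finset.sum_mul]
      _ ≤ (4 * n * (4 * n)) * (q / n) := by gcongr
      _ = _ := by field_simp; ring
  have hsplit : ∑ i, ∑ j, (k i : ℝ) * l j * (A - E) i j ≤
      ∑ i, ∑ j, lightPart q k l i j * (A - E) i j +
      ∑ i, ∑ j, (if q < |(k i : ℝ) * l j| then |(k i : ℝ) * l j| * A i j else 0) +
      ∑ i, ∑ j, (if q < |(k i : ℝ) * l j| then |(k i : ℝ) * l j| * E i j else 0) := by
    simp only [← Finset.sum_add_distrib]
    refine Finset.sum_le_sum fun i _ => Finset.sum_le_sum fun j _ => ?_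
    unfold lightPart
    by_cases h : |(k i : ℝ) * l j| ≤ q
    · rw [if_pos h, if_neg (not_lt.2 h), if_neg (not_lt.2 h), add_zero, add_zero]
    · rw [if_neg h, if_pos (not_le.1 h), if_pos (not_le.1 h), Matrix.sub_apply]
      have h1 := mul_le_mul_of_nonneg_right (le_abs_self ((k i : ℝ) * l j)) (hA i j)
      have h2 := mul_le_mul_of_nonneg_right (neg_abs_le ((k i : ℝ) * l j)) (hE0 i j)
      linarith
  have := hlight k (mem_intNet.2 hk) l (mem_intNet.2 hl)
  rw [heq]
  linarith

theorem theorem4 (M : ℕ) (hM : 2 ≤ M) (τ : ℝ) (hτ : 1 < τ) (K : ℝ) (hK : 0 < K) :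
    ∃ C : ℝ, 0 < C ∧
      ∀ (n : ℕ) (w : Finset (Fin n) → ℝ)
        (Ω : Type*) [MeasurableSpace Ω] (μ : Measure Ω) [IsProbabilityMeasure μ]
        (H : Ω → Set (Finset (Fin n))),
        IsInhomogeneousHypergraph μ M w H →
        1 - 2 * (Real.exp 1 / 2) ^ (-(n : ℝ)) - (n : ℝ) ^ (-K) ≤
          μ.real {ω |
            matrixSpectralNorm
              (regularize
                (hyperAdjMatrix M (H ω) - expectedMatrix μ (fun ω' => hyperAdjMatrix M (H ω')))
                {i | rowSum (hyperAdjMatrix M (H ω)) i ≤ τ * degreeParam M w}) ≤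
              C * Real.sqrt (degreeParam M w)} := by
  refine ⟨20 * (M : ℝ) ^ 2 + 16 + 8 * (64 * Real.exp 2 + 8 * τ +
    96 * (2 * (M : ℝ) ^ 2 * (K + 3)) + 64), by positivity, fun n w Ω _ μ _ H hH => ?_⟩
  set d := degreeParam M w with hd
  set E := expectedMatrix μ (fun ω' => hyperAdjMatrix M (H ω')) with hE
  have hrpow : 0 ≤ (n : ℝ) ^ (-K) := Real.rpow_nonneg (Nat.cast_nonneg n) _
  have hrpow' : 0 ≤ (Real.exp 1 / 2) ^ (-(n : ℝ)) := by positivity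
  -- For `n = 0` the power of `exp 1 / 2` is 1, so the lower bound is negative.
  rcases Nat.eq_zero_or_pos n with rfl | hn
  · refine le_trans ?_ measureReal_nonneg
    rw [Nat.cast_zero, neg_zero, Real.rpow_zero]
    rw [Nat.cast_zero] at hrpow
    linarith
  -- For `d = 0` the mean vanishes, and rows indexed by the retained set have nonnegative entries
  -- with sum at most 0, so the regularized matrix is zero everywhere.
  rcases hH.degreeParam_nonneg.eq_or_lt with h0 | h0
  · rw [← hd] at h0
    refine le_trans (b := (1 : ℝ)) (by linarith) (le_of_eq ?_)
    rw [← probReal_univ (μ := μ)]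
    congr 1
    symm
    rw [Set.eq_univ_iff_forall]
    intro ω
    have hzero : regularize (hyperAdjMatrix M (H ω) - E)
        {i | rowSum (hyperAdjMatrix M (H ω)) i ≤ τ * d} = 0 := by
      ext i j
      simp only [regularize, Matrix.of_apply, Matrix.zero_apply, Matrix.sub_apply]
      split_ifs with h
      · have h1 : rowSum (hyperAdjMatrix M (H ω)) i ≤ τ * d := h.1
        rw [← h0, mul_zero] at h1
        have h2 : hyperAdjMatrix M (H ω) i j ≤ rowSum (hyperAdjMatrix M (H ω)) i :=
          Finset.single_le_sum (f := fun j => hyperAdjMatrix M (H ω) i j)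
            (fun j _ => hyperAdjMatrix_nonneg (H ω) i j) (Finset.mem_univ j)
        have h3 := hyperAdjMatrix_nonneg (M := M) (H ω) i j
        have h4 := hH.expectedMatrix_nonneg i j
        have h5 := hH.expectedMatrix_le i j
        rw [← hd, ← h0, zero_div] at h5
        linarith
      · rfl
    rw [Set.mem_ofPred_eq, hzero, ← h0]
    simp [matrixSpectralNorm]
  set good := {ω | matrixSpectralNorm (regularize (hyperAdjMatrix M (H ω) - E)
    {i | rowSum (hyperAdjMatrix M (H ω)) i ≤ τ * d}) ≤ (20 * (M : ℝ) ^ 2 + 16 +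
      8 * (64 * Real.exp 2 + 8 * τ + 96 * (2 * (M : ℝ) ^ 2 * (K + 3)) + 64)) * √d}
  have h1 := hH.measureReal_exists_light_sum_ge_le hn hM h0
  have h2 := hH.measureReal_not_hasDiscrepancy_le hn hM h0 hK
  set bad₁ := {ω | ∃ k ∈ intNet n, ∃ l ∈ intNet n, 20 * (M : ℝ) ^ 2 * n * √(degreeParam M w) ≤
      ∑ i, ∑ j, lightPart (√(degreeParam M w)) k l i j * (hyperAdjMatrix M (H ω) -
        expectedMatrix μ (fun ω' => hyperAdjMatrix M (H ω'))) i j}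
  set bad₂ := {ω | ¬ HasDiscrepancy (hyperAdjMatrix M (H ω)) (degreeParam M w)
      (2 * (M : ℝ) ^ 2 * (K + 3))}
  have hcover : Set.univ ⊆ good ∪ (bad₁ ∪ bad₂) := by
    intro ω _
    by_cases hb₁ : ω ∈ bad₁
    · exact Or.inr (Or.inl hb₁)
    by_cases hb₂ : ω ∈ bad₂
    · exact Or.inr (Or.inr hb₂)
    refine Or.inl (matrixSpectralNorm_regularize_le hn h0 (by linarith) (by positivity)
      (by positivity) (hyperAdjMatrix_nonneg (H ω)) (hyperAdjMatrix_symm (H ω))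
      hH.expectedMatrix_nonneg hH.expectedMatrix_le (not_not.1 hb₂) fun k hk l hl => ?_)
    by_contra h
    exact hb₁ ⟨k, hk, l, hl, (not_le.1 h).le⟩
  have hone : (1 : ℝ) ≤ μ.real good + (μ.real bad₁ + μ.real bad₂) := by
    rw [← probReal_univ (μ := μ)]
    exact (measureReal_mono hcover).trans ((measureReal_union_le _ _).trans
      (add_le_add_right (measureReal_union_le _ _) _))
  -- The light pairs fail with probability at most `exp (-4 n)`, well below what is allowed, since
  -- `log (e / 2) = 1 - log 2 < 4`.
  have hexp : Real.exp (-(4 * n)) ≤ 2 * (Real.exp 1 / 2) ^ (-(n : ℝ)) := by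
    have h3 : Real.exp (-(4 * n)) ≤ (Real.exp 1 / 2) ^ (-(n : ℝ)) := by
      rw [Real.rpow_def_of_pos (by positivity), Real.exp_le_exp,
        Real.log_div (Real.exp_pos 1).ne' two_ne_zero, Real.log_exp]
      have := Real.log_two_gt_d9
      have hn' : (0 : ℝ) ≤ n := Nat.cast_nonneg n
      nlinarith
    linarith
  linarith
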